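/- Let $G$ and $H$ be sofic groups, let $\Gamma\le G$ be an amenable subgroup, and let $\varphi:\Gamma\to H$ be an injective homomorphism. Then the free product with amalgamation $G*_{\varphi}H$, i.e. the quotient of the free product $G*H$ by the relations $\gamma=\varphi(\gamma)$ $(\gamma\in\Gamma)$, is sofic. Here the terms are used as follows. Let $K$ be a finitely generated group with a finite symmetric generating system $S$, and let $\mathrm{Cay}(K,S)$ be its Cayley graph, with an edge labeled $s$ from $x$ to $xs$ for all $x\in K$, $s\in S$. For an integer $r\ge 1$, a finite directed graph $A$ with edges labeled by elements of $S$ is an $r$-approximation of $\mathrm{Cay}(K,S)$ if there is a set $W$ of vertices of $A$ with $|W|>(1-\frac1r)|V(A)|$ such that for each $p\in W$ the $r$-neighborhood of $p$ in $A$ is isomorphic, as a rooted edge-labeled graph, to the $r$-neighborhood of a vertex of $\mathrm{Cay}(K,S)$. The group $K$ is sofic if for every $r\ge1$ there is an $r$-approximation of $\mathrm{Cay}(K,S)$. It is amenable if there is a sequence $F_1,F_2,\dots$ of finite spanned subgraphs of $\mathrm{Cay}(K,S)$ such that for every $r\ge1$ all but finitely many $F_n$ are $r$-approximations of $\mathrm{Cay}(K,S)$.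 Neither property depends on the choice of $S$. An arbitrary group is sofic (respectively amenable) if all of its finitely generated subgroups are sofic (respectively amenable). -/

import Mathlib

/-- A directed graph on the vertex set `V` whose edges are labeled by elements of `L`:
`A.edge l x y` says that there is an edge from `x` to `y` with label `l`. -/
structure LabeledGraph (L V : Type*) where
  edge : L → V → V → Prop

namespace LabeledGraph

/-- The vertices at distance at most `r` from `p`; directions of edges are ignored. -/
def ball {L V : Type*} (A : LabeledGraph L V) (p : V) : ℕ → Set V
  | 0 => {p}
  | n + 1 => {y | y ∈ ball A p n ∨ ∃ x ∈ ball A p n, ∃ l : L, A.edge l x y ∨ A.edge l y x}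

theorem mem_ball_self {L V : Type*} (A : LabeledGraph L V) (p : V) (r : ℕ) :
    p ∈ A.ball p r := by
  induction r with
  | zero => exact rfl
  | succ n ih => exact Or.inl ih

/-- The spanned subgraph of `A` on the vertex set `F`. -/
def induce {L V : Type*} (A : LabeledGraph L V) (F : Set V) : LabeledGraph L F where
  edge l x y := A.edge l x y

/-- The `r`-neighborhood of `p` in `A` and the `r`-neighborhood of `q` in `B`, as spanned
subgraphs, are isomorphic as rooted edge-labeled graphs. -/
def NbhdIso {L V V' : Type*} (r : ℕ) (A : LabeledGraph L V) (p : V)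
    (B : LabeledGraph L V') (q : V') : Prop :=
  ∃ f : A.ball p r ≃ B.ball q r,
    f ⟨p, A.mem_ball_self p r⟩ = ⟨q, B.mem_ball_self q r⟩ ∧
    ∀ (l : L) (x y : A.ball p r), A.edge l x y ↔ B.edge l (f x) (f y)

end LabeledGraph

/-- The Cayley graph `Cay(Γ, S)`: an edge labeled `s` goes from `x` to `x * s`. -/
def cayleyGraph {Γ : Type*} [Group Γ] (S : Finset Γ) : LabeledGraph S Γ where
  edge s x y := y = x * (s : Γ)

/-- `S` is a finite symmetric generating system of `Γ`. -/
def IsSymmGen {Γ : Type*} [Group Γ] (S : Finset Γ) : Prop :=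
  (∀ s ∈ S, s⁻¹ ∈ S) ∧ Subgroup.closure (S : Set Γ) = ⊤

/-- The finite graph `A`, labeled by `S`, is an `r`-approximation of `Cay(Γ, S)`. -/
def IsApproximation {Γ : Type*} [Group Γ] (S : Finset Γ) (r : ℕ)
    {V : Type*} [Fintype V] (A : LabeledGraph S V) : Prop :=
  ∃ W : Finset V, (1 - 1 / (r : ℝ)) * (Fintype.card V : ℝ) < (W.card : ℝ) ∧
    ∀ p ∈ W, ∃ g : Γ, LabeledGraph.NbhdIso r A p (cayleyGraph S) g

/-- Soficity of a finitely generated group. (The condition on `S` does not depend on the choice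
of `S`.) -/
def IsSoficFG (Γ : Type*) [Group Γ] : Prop :=
  ∀ S : Finset Γ, IsSymmGen S → ∀ r : ℕ, 1 ≤ r →
    ∃ (V : Type) (_ : Fintype V) (A : LabeledGraph S V), IsApproximation S r A

/-- A group is sofic if all of its finitely generated subgroups are. -/
def IsSofic (G : Type*) [Group G] : Prop :=
  ∀ K : Subgroup G, K.FG → IsSoficFG K

/-- `F` is a Følner sequence in `Cay(Γ, S)`: for every `r`, all but finitely many of the spanned
subgraphs on the finite sets `F n` are `r`-approximations. -/
def IsFolnerSeq {Γ : Type*} [Group Γ] (S : Finset Γ) (F : ℕ → Finset Γ) : Prop :=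
  ∀ r : ℕ, 1 ≤ r → ∀ᶠ n in Filter.atTop,
    IsApproximation S r ((cayleyGraph S).induce (F n : Set Γ))

/-- Amenability of a finitely generated group. (The condition on `S` does not depend on the choice
of `S`.) -/
def IsAmenableFG (Γ : Type*) [Group Γ] : Prop :=
  ∃ S : Finset Γ, IsSymmGen S ∧ ∃ F : ℕ → Finset Γ, IsFolnerSeq S F

/-- A group is amenable if all of its finitely generated subgroups are. -/
def IsAmenable (G : Type*) [Group G] : Prop :=
  ∀ K : Subgroup G, K.FG → IsAmenableFG K

/-- The free product of `G` and `H` amalgamated along `φ : Γ → H`, where `Γ ≤ G`: the quotient of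
the free product by the relations `γ = φ γ` for `γ ∈ Γ`. -/
abbrev AmalgamatedProduct {G H : Type*} [Group G] [Group H] (Γ : Subgroup G) (φ : Γ →* H) :
    Type _ :=
  Monoid.Coprod G H ⧸ Subgroup.normalClosure
    (Set.range fun γ : Γ =>
      (Monoid.Coprod.inl (γ : G) : Monoid.Coprod G H) * (Monoid.Coprod.inr (φ γ))⁻¹)

open scoped Pointwise

/-! Soficity is first translated into `HasPermApprox`: finite permutation models that are
multiplicative and free at most points. Let $\sigma$ on $X$ and $\tau$ on $Y$ be such models for $G$
and $H$. They must be changed so that they agree on $\Gamma$ while alternating words act almost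
freely.

Amenability gives, via a Følner set and a random enumeration, maps $t:X\to\Gamma$ and $c:X\to X$
with $t(bx)=b\,t(x)$ and $c(bx)=c(x)$ for most $x$ when $b\in\Gamma$, but $c(gx)\ne c(x)$ for most
$x$ when $g\notin\Gamma$ (`exists_equivariant_position`). Conjugating $\sigma\times 1$ on $X\times
Y$ by $(x,y)\mapsto(x,\tau(t(x))y)$ makes $b\in\Gamma$ act almost as $\sigma(b)\times\tau(b)$
(`density_skewPerm_ne_le`). The same is done for $H$, so the two actions almost agree on $\Gamma$.

For freeness, take a finite group $K$ generated by involutions $a_i$, $i\in X\sqcup Y$, without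
short relations. Let $g$ act on the extra factor $K$ through $a_{c(gx)}a_{c(x)}$, and similarly for
$H$. This is almost trivial on $\Gamma$. An alternating word with letters outside $\Gamma$
multiplies $K$ by a product of involutions which, at most points, has no equal neighbours, hence is
nontrivial (`density_fixed_word_le`).

Modulo permutations moving few points, the two families become homomorphisms that agree on $\Gamma$
and so extend to the amalgamated product. Only the existence of reduced words is needed, not their
uniqueness. -/

/-- The proportion of a finite type `V` that is taken up by the set `s`. -/
noncomputable def density {V : Type*} (s : Set V) : ℝ := (s.ncard : ℝ) / Nat.card V

/-! ### Densities of subsets of finite sets -/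

section density
variable {V V' : Type*}

theorem density_nonneg (s : Set V) : 0 ≤ density s := by unfold density; positivity

theorem density_mono [Finite V] {s t : Set V} (h : s ⊆ t) : density s ≤ density t := by
  unfold density
  gcongr
  exact t.toFinite

theorem density_empty : density (∅ : Set V) = 0 := by simp [density]

theorem density_union_le (s t : Set V) : density (s ∪ t) ≤ density s + density t := by
  unfold density
  rw [← add_div]
  gcongr
  exact_mod_cast Set.ncard_union_le s t

theorem density_biUnion_le [Finite V] {ι : Type*} (I : Finset ι) (s : ι → Set V) :
    density (⋃ i ∈ I, s i) ≤ ∑ i ∈ I, density (s i) := by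
  classical
  induction I using Finset.induction_on with
  | empty => simp [density_empty]
  | insert i I hi ih =>
    rw [Finset.sum_insert hi, Finset.set_biUnion_insert]
    exact (density_union_le _ _).trans (by gcongr)

theorem density_preimage (e : V ≃ V') (s : Set V') : density (e ⁻¹' s) = density s := by
  unfold density
  rw [Nat.card_congr e, ← Set.ncard_image_of_injective _ e.injective, e.image_preimage]

theorem density_le_of_preimage [Finite V] (e : V ≃ V') {s : Set V'} {t : Set V}
    (h : ∀ v, e v ∈ s → v ∈ t) : density s ≤ density t := by
  rw [← density_preimage e]
  exact density_mono h

theorem density_le_of_fiber [Finite V] [Finite V'] {s : Set (V × V')} {ε : ℝ} (hε : 0 ≤ ε)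
    (h : ∀ x, density {y | (x, y) ∈ s} ≤ ε) : density s ≤ ε := by
  classical
  have := Fintype.ofFinite V
  have hs : (s.ncard : ℝ) = ∑ x : V, (({y | (x, y) ∈ s} : Set V').ncard : ℝ) := by
    rw [← Nat.cast_sum]
    congr 1
    have e : s ≃ Σ x : V, ({y | (x, y) ∈ s} : Set V') :=
      { toFun := fun p => ⟨p.1.1, p.1.2, p.2⟩
        invFun := fun p => ⟨(p.1, p.2.1), p.2.2⟩
        left_inv := fun _ => rfl
        right_inv := fun _ => rfl }
    have h1 : s.ncard = Nat.card s := rfl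
    rw [h1, Nat.card_congr e, Nat.card_sigma]
    rfl
  unfold density at h ⊢
  rw [Nat.card_prod, hs, Nat.cast_mul]
  -- For empty `V'` the density is `0 / 0 = 0`.
  by_cases h0 : (Nat.card V' : ℝ) = 0
  · simpa [h0] using hε
  have hpos : (0 : ℝ) < Nat.card V' := by positivity
  have h2 : ∀ x, (({y | (x, y) ∈ s} : Set V').ncard : ℝ) ≤ ε * Nat.card V' := fun x =>
    (div_le_iff₀ hpos).1 (h x)
  apply div_le_of_le_mul₀ (by positivity) hε
  calc _ ≤ ∑ x : V, ε * (Nat.card V' : ℝ) := Finset.sum_le_sum fun x _ => h2 x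
    _ = _ := by simp; ring

theorem density_preimage_snd_le [Finite V] [Finite V'] (s : Set V') :
    density (Prod.snd ⁻¹' s : Set (V × V')) ≤ density s :=
  density_le_of_fiber (density_nonneg s) fun _ => le_rfl

theorem density_preimage_fst_le [Finite V] [Finite V'] (s : Set V) :
    density (Prod.fst ⁻¹' s : Set (V × V')) ≤ density s := by
  rw [← density_preimage (Equiv.prodComm V' V)]
  exact density_preimage_snd_le s

theorem density_lt_iff_ncard_compl [Finite V] [Nonempty V] {s : Set V} {ε : ℝ} :
    density s < ε ↔ (1 - ε) * Nat.card V < (sᶜ.ncard : ℝ) := by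
  have hpos : (0 : ℝ) < Nat.card V := by exact_mod_cast Nat.card_pos
  have h := Set.ncard_add_ncard_compl s
  have h' : (s.ncard : ℝ) + sᶜ.ncard = Nat.card V := by exact_mod_cast h
  unfold density
  rw [div_lt_iff₀ hpos]
  constructor <;> intro h <;> nlinarith

end density

/-! ### Minima of random enumerations -/

/-- A uniformly random enumeration of `V` attains its minimum over `A` equally often at all
points of `A`. -/
theorem density_argmin_le {V : Type*} [Finite V] {n : ℕ} [DecidableEq V] (A : Finset V) {c : V}
    (hc : c ∈ A) :
    density {u : V ≃ Fin n | ∀ x ∈ A, u c ≤ u x} ≤ 1 / (A.card : ℝ) := by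
  classical
  set M : V → Set (V ≃ Fin n) := fun c => {u | ∀ x ∈ A, u c ≤ u x} with hM
  have hpos : (0 : ℝ) < A.card := by exact_mod_cast Finset.card_pos.2 ⟨c, hc⟩
  have heq : ∀ d ∈ A, (M d).ncard = (M c).ncard := by
    intro d hd
    -- Precomposing with the transposition of `c` and `d` preserves `A` and exchanges the two
    -- events.
    refine Set.ncard_congr (fun u _ => (Equiv.swap c d).trans u) ?_ ?_ ?_
    · intro u hu x hx
      simp only [Equiv.trans_apply, Equiv.swap_apply_left]
      refine hu _ ?_
      rcases eq_or_ne x c with rfl | h1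
      · simpa using hd
      rcases eq_or_ne x d with rfl | h2
      · simpa using hc
      rwa [Equiv.swap_apply_of_ne_of_ne h1 h2]
    · intro u v _ _ h
      ext x
      have := congrArg (fun w : V ≃ Fin n => w (Equiv.swap c d x)) h
      simpa using congrArg Fin.val this
    · intro u hu
      refine ⟨(Equiv.swap c d).trans u, ?_, ?_⟩
      · intro x hx
        simp only [Equiv.trans_apply, Equiv.swap_apply_right]
        refine hu _ ?_
        rcases eq_or_ne x c with rfl | h1
        · simpa using hd
        rcases eq_or_ne x d with rfl | h2
        · simpa using hc
        rwa [Equiv.swap_apply_of_ne_of_ne h1 h2]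
      · ext x; simp
  have hdisj : (A : Set V).PairwiseDisjoint M := by
    intro d hd e he hde
    refine Set.disjoint_left.2 fun u h1 h2 => hde ?_
    exact u.injective (le_antisymm (h1 e he) (h2 d hd))
  have hsum : ∑ d ∈ A, (M d).ncard ≤ Nat.card (V ≃ Fin n) := by
    have h1 : (⋃ d ∈ A, M d).ncard = ∑ d ∈ A, (M d).ncard := by
      have := A.finite_toSet.ncard_biUnion (fun d _ => (M d).toFinite) hdisj
      rwa [finsum_mem_coe_finset] at this
    rw [← h1]
    exact Set.ncard_le_card _
  rw [Finset.sum_congr rfl heq, Finset.sum_const, smul_eq_mul] at hsum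
  have hsum' : (A.card : ℝ) * (M c).ncard ≤ Nat.card (V ≃ Fin n) := by exact_mod_cast hsum
  unfold density
  apply div_le_of_le_mul₀ (by positivity) (by positivity)
  rw [div_mul_eq_mul_div, one_mul, le_div_iff₀ hpos]
  linarith

theorem density_argmin_mem_le {V : Type*} [Finite V] {n : ℕ} [DecidableEq V] (A I : Finset V)
    (hI : I ⊆ A) :
    density {u : V ≃ Fin n | ∃ c ∈ I, ∀ x ∈ A, u c ≤ u x} ≤ (I.card : ℝ) / A.card := by
  have h : {u : V ≃ Fin n | ∃ c ∈ I, ∀ x ∈ A, u c ≤ u x} =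
      ⋃ c ∈ I, {u : V ≃ Fin n | ∀ x ∈ A, u c ≤ u x} := by ext; simp
  rw [h]
  refine (density_biUnion_le _ _).trans ?_
  refine (Finset.sum_le_sum fun c hc => density_argmin_le A (hI hc)).trans ?_
  simp [div_eq_mul_inv]

/-! ### A finite group generated by involutions without short relations -/

/-- Words without equal consecutive letters, of length at most `M`. -/
abbrev ShortReducedWord (I : Type*) (M : ℕ) : Type _ :=
  {l : List I // l.IsChain (· ≠ ·) ∧ l.length ≤ M}

namespace ShortReducedWord
variable {I : Type*} {M : ℕ}

instance [Finite I] : Finite (ShortReducedWord I M) :=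
  Set.Finite.to_subtype ((List.finite_length_le I M).subset fun _ h => h.2)

open Classical in
/-- Left multiplication by the letter `i`, cut off at length `M`. -/
noncomputable def toggleList (M : ℕ) (i : I) (l : List I) : List I :=
  if l.head? = some i then l.tail else if l.length < M then i :: l else l

/-- In a reduced word the letter after a leading `i` is not `i`, so deleting and prepending undo
each other. A word too long to be extended is fixed, which keeps the map an involution. -/
theorem toggleList_spec (i : I) {l : List I} (h : l.IsChain (· ≠ ·) ∧ l.length ≤ M) :
    ((toggleList M i l).IsChain (· ≠ ·) ∧ (toggleList M i l).length ≤ M) ∧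
      toggleList M i (toggleList M i l) = l := by
  obtain ⟨h1, h2⟩ := h
  unfold toggleList
  cases l with
  | nil =>
    by_cases hM : 0 < M
    · simp [hM]; omega
    · simp [hM]
  | cons j l =>
    by_cases hj : j = i
    · subst hj
      have h3 : l.head? ≠ some j := by
        intro h
        cases l with
        | nil => simp at h
        | cons k l => simp at h; subst h; simp at h1
      simp only [List.length_cons] at h2
      refine ⟨⟨?_, ?_⟩, ?_⟩
      · simpa using h1.tail
      · simp; omega
      · simp [h3]; omega
    · by_cases hM : (j :: l).length < M
      · simp only [List.head?_cons, Option.some.injEq, hj, if_false, hM, if_true]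
        refine ⟨⟨?_, ?_⟩, ?_⟩
        · exact List.isChain_cons_cons.2 ⟨fun h => hj h.symm, h1⟩
        · simp only [List.length_cons] at hM ⊢; omega
        · simp
      · simp only [List.head?_cons, Option.some.injEq, hj, if_false, hM]
        exact ⟨⟨h1, h2⟩, trivial⟩

/-- Left multiplication by the letter `i`, cut off at length `M`, as a permutation. -/
noncomputable def toggle (M : ℕ) (i : I) : Equiv.Perm (ShortReducedWord I M) :=
  Function.Involutive.toPerm
    (fun l => ⟨toggleList M i l.1, (toggleList_spec i l.2).1⟩)
    (fun l => Subtype.ext (toggleList_spec i l.2).2)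

theorem toggle_mul_self (i : I) : toggle M i * toggle M i = 1 := by
  ext l : 1
  exact (Function.Involutive.toPerm_involutive _) l

theorem prod_toggle_apply_nil (l : List I) (h : l.IsChain (· ≠ ·) ∧ l.length ≤ M) :
    (((l.map (toggle M)).prod ⟨[], by simp⟩ : ShortReducedWord I M)).1 = l := by
  induction l with
  | nil => rfl
  | cons i l ih =>
    simp only [List.length_cons] at h
    have ih := ih ⟨h.1.tail, by omega⟩
    rw [List.map_cons, List.prod_cons, Equiv.Perm.mul_apply]
    change toggleList M i _ = _
    rw [ih]
    unfold toggleList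
    have h3 : l.head? ≠ some i := by
      intro h'
      cases l with
      | nil => simp at h'
      | cons k l => simp at h'; subst h'; simp at h
    rw [if_neg h3, if_pos (by omega)]

end ShortReducedWord

/-- Finite quotients of a free product of groups of order two that are injective on a ball. -/
theorem exists_finite_group_of_involutions (I : Type) [Finite I] (M : ℕ) :
    ∃ (K : Type) (_ : Group K) (_ : Finite K) (a : I → K), (∀ i, a i * a i = 1) ∧
      ∀ l : List I, l ≠ [] → l.IsChain (· ≠ ·) → l.length ≤ M → (l.map a).prod ≠ 1 := by
  refine ⟨Equiv.Perm (ShortReducedWord I M), inferInstance, inferInstance,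
    ShortReducedWord.toggle M, ShortReducedWord.toggle_mul_self, fun l hl h1 h2 h => hl ?_⟩
  have := ShortReducedWord.prod_toggle_apply_nil l ⟨h1, h2⟩
  rw [h] at this
  exact this.symm

/-! ### Permutation models and Cayley graphs -/

/-- At the point `v` the map `σ` is multiplicative and free as far as products of elements of `E`
are concerned. -/
def IsGoodAt {G V : Type*} [Group G] (σ : G → Equiv.Perm V) (E : Finset G) (v : V) : Prop :=
  ∀ a ∈ E, ∀ b ∈ E, σ (a * b) v = σ a (σ b v) ∧ (σ a v = σ b v → a = b)

theorem IsGoodAt.mono {G V : Type*} [Group G] {σ : G → Equiv.Perm V} {E E' : Finset G} {v : V}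
    (h : IsGoodAt σ E v) (hE : E' ⊆ E) : IsGoodAt σ E' v :=
  fun a ha b hb => h a (hE ha) b (hE hb)

/-- If `v` is good for a set that contains `1`, then `σ 1` fixes `v`. -/
theorem IsGoodAt.one_apply {G V : Type*} [Group G] {σ : G → Equiv.Perm V} {E : Finset G} {v : V}
    (h : IsGoodAt σ E v) (h1 : 1 ∈ E) : σ 1 v = v := by
  have := (h 1 h1 1 h1).1
  rw [mul_one] at this
  exact ((σ 1).injective this).symm

theorem IsGoodAt.inv_apply {G V : Type*} [Group G] {σ : G → Equiv.Perm V} {E : Finset G} {v : V}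
    (h : IsGoodAt σ E v) {a b : G} (ha : a ∈ E) (hb : a⁻¹ * b ∈ E) :
    (σ a)⁻¹ (σ b v) = σ (a⁻¹ * b) v := by
  rw [Equiv.Perm.inv_eq_iff_eq, ← (h a ha _ hb).1, mul_inv_cancel_left]

/-- Soficity in terms of almost multiplicative, almost free maps to finite symmetric groups. -/
def HasPermApprox (G : Type*) [Group G] : Prop :=
  ∀ (E : Finset G) (ε : ℝ), 0 < ε → ∃ (V : Type) (_ : Finite V) (_ : Nonempty V)
    (σ : G → Equiv.Perm V), density {v | ¬ IsGoodAt σ E v} ≤ ε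

theorem HasPermApprox.of_injective {G H : Type*} [Group G] [Group H] (hG : HasPermApprox G)
    (f : H →* G) (hf : Function.Injective f) : HasPermApprox H := by
  classical
  intro E ε hε
  obtain ⟨V, hV, hV', σ, hσ⟩ := hG (E.image f) ε hε
  refine ⟨V, hV, hV', fun h => σ (f h), (density_mono ?_).trans hσ⟩
  intro v hv hgood
  refine hv fun a ha b hb => ?_
  have := hgood _ (Finset.mem_image_of_mem f ha) _ (Finset.mem_image_of_mem f hb)
  rw [← map_mul] at this
  exact ⟨this.1, fun h => hf (this.2 h)⟩

section Cayley
variable {K V : Type*} [Group K]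

theorem LabeledGraph.ball_mono {L V : Type*} (A : LabeledGraph L V) (p : V) {m n : ℕ}
    (h : m ≤ n) : A.ball p m ⊆ A.ball p n := by
  induction h with
  | refl => exact subset_rfl
  | step _ ih => exact fun x hx => Or.inl (ih hx)

theorem LabeledGraph.mem_ball_succ_of_edge {L V : Type*} (A : LabeledGraph L V) {p x y : V}
    {n : ℕ} (hx : x ∈ A.ball p n) {l : L} (h : A.edge l x y) : y ∈ A.ball p (n + 1) :=
  Or.inr ⟨x, hx, l, Or.inl h⟩

theorem mem_cayleyGraph_ball_succ {S : Finset K} {n : ℕ} {x s : K}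
    (hx : x ∈ (cayleyGraph S).ball 1 n) (hs : s ∈ S) : x * s ∈ (cayleyGraph S).ball 1 (n + 1) :=
  Or.inr ⟨x, hx, ⟨s, hs⟩, Or.inl rfl⟩

theorem mem_cayleyGraph_ball_succ' {S : Finset K} {n : ℕ} {x s : K}
    (hx : x ∈ (cayleyGraph S).ball 1 n) (hs : s ∈ S) :
    x * s⁻¹ ∈ (cayleyGraph S).ball 1 (n + 1) :=
  Or.inr ⟨x, hx, ⟨s, hs⟩, Or.inr (by simp [cayleyGraph])⟩

theorem finite_cayleyGraph_ball (S : Finset K) (n : ℕ) : ((cayleyGraph S).ball 1 n).Finite := by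
  induction n with
  | zero => exact Set.finite_singleton _
  | succ n ih =>
    refine (ih.union ((ih.mul S.finite_toSet).union (ih.mul S.finite_toSet.inv))).subset ?_
    rintro y (hy | ⟨x, hx, s, hs | hs⟩)
    · exact Or.inl hy
    · exact Or.inr (Or.inl ⟨x, hx, s, s.2, hs.symm⟩)
    · refine Or.inr (Or.inr ⟨x, hx, (s : K)⁻¹, by simp, ?_⟩)
      change x = y * s at hs
      simp [hs]

/-- The graph of a family of permutations: the edge labeled `s` leads from `v` to `σ s⁻¹ v`. -/
def permGraph (σ : K → Equiv.Perm V) (S : Finset K) : LabeledGraph S V where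
  edge s v w := w = σ (s : K)⁻¹ v

/-- The group element `x` corresponds to the point `σ x⁻¹ v`: the inverse turns right multiplication
in the Cayley graph into the left action, as `(x * s)⁻¹ = s⁻¹ * x⁻¹`. -/
theorem permGraph_ball_eq {σ : K → Equiv.Perm V} {S E : Finset K} {r : ℕ}
    (hE : ∀ x ∈ (cayleyGraph S).ball 1 r, x⁻¹ ∈ E) (hS : ∀ s ∈ S, s⁻¹ ∈ E) {v : V}
    (hv : IsGoodAt σ E v) :
    ∀ n ≤ r, (permGraph σ S).ball v n = (fun x => σ x⁻¹ v) '' (cayleyGraph S).ball 1 n := by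
  intro n
  have h1 : (1 : K) ∈ E := by simpa using hE 1 (LabeledGraph.mem_ball_self _ _ _)
  induction n with
  | zero =>
    intro _
    simp [LabeledGraph.ball, hv.one_apply h1]
  | succ n ih =>
    intro hn
    have ih := ih (by omega)
    have hE' : ∀ x ∈ (cayleyGraph S).ball 1 n, x⁻¹ ∈ E := fun x hx =>
      hE x (LabeledGraph.ball_mono _ _ (by omega) hx)
    ext w
    constructor
    · rintro (hw | ⟨u, hu, s, hs⟩)
      · rw [ih] at hw
        obtain ⟨x, hx, rfl⟩ := hw
        exact ⟨x, Or.inl hx, rfl⟩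
      · rw [ih] at hu
        obtain ⟨x, hx, rfl⟩ := hu
        rcases hs with hs | hs
        · refine ⟨x * s, mem_cayleyGraph_ball_succ hx s.2, ?_⟩
          change w = σ (s : K)⁻¹ (σ x⁻¹ v) at hs
          rw [hs, ← (hv _ (hS s s.2) _ (hE' x hx)).1, ← mul_inv_rev]
        · have hy := mem_cayleyGraph_ball_succ' hx s.2
          refine ⟨x * (s : K)⁻¹, hy, ?_⟩
          change σ x⁻¹ v = σ (s : K)⁻¹ w at hs
          apply (σ (s : K)⁻¹).injective
          rw [← hs]
          change σ (s : K)⁻¹ (σ (x * (s : K)⁻¹)⁻¹ v) = _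
          rw [← (hv _ (hS s s.2) _ (hE _ (LabeledGraph.ball_mono _ _ hn hy))).1]
          simp
    · rintro ⟨y, hy | ⟨x, hx, s, hs⟩, rfl⟩
      · left
        rw [ih]
        exact ⟨y, hy, rfl⟩
      · right
        refine ⟨σ x⁻¹ v, by rw [ih]; exact ⟨x, hx, rfl⟩, s, ?_⟩
        rcases hs with hs | hs
        · left
          change y = x * s at hs
          change σ y⁻¹ v = σ (s : K)⁻¹ (σ x⁻¹ v)
          rw [← (hv _ (hS s s.2) _ (hE' x hx)).1, ← mul_inv_rev, hs]
        · right
          change x = y * s at hs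
          change σ x⁻¹ v = σ (s : K)⁻¹ (σ y⁻¹ v)
          have hy : y ∈ (cayleyGraph S).ball 1 (n + 1) := by
            have := mem_cayleyGraph_ball_succ' hx s.2
            rwa [hs, mul_inv_cancel_right] at this
          rw [← (hv _ (hS s s.2) _ (hE _ (LabeledGraph.ball_mono _ _ hn hy))).1, ← mul_inv_rev, hs]

/-- Radius `r + 1` is needed in `hE`: to see that an edge between points of the `r`-ball comes from
the Cayley graph, freeness is applied to `x * s`, which may lie one step outside. -/
theorem permGraph_nbhdIso {σ : K → Equiv.Perm V} {S E : Finset K} {r : ℕ}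
    (hE : ∀ x ∈ (cayleyGraph S).ball 1 (r + 1), x⁻¹ ∈ E) (hS : ∀ s ∈ S, s⁻¹ ∈ E) {v : V}
    (hv : IsGoodAt σ E v) : LabeledGraph.NbhdIso r (permGraph σ S) v (cayleyGraph S) 1 := by
  have h1 : (1 : K) ∈ E := by simpa using hE 1 (LabeledGraph.mem_ball_self _ _ _)
  have hE' : ∀ x ∈ (cayleyGraph S).ball 1 r, x⁻¹ ∈ E := fun x hx => hE x (Or.inl hx)
  have hball := permGraph_ball_eq hE' hS hv r le_rfl
  let f : (cayleyGraph S).ball 1 r → (permGraph σ S).ball v r := fun x =>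
    ⟨σ (x : K)⁻¹ v, by rw [hball]; exact ⟨x, x.2, rfl⟩⟩
  have hf : Function.Bijective f := by
    constructor
    · intro x y h
      have := (hv _ (hE' x x.2) _ (hE' y y.2)).2 (congrArg Subtype.val h)
      exact Subtype.ext (inv_injective this)
    · rintro ⟨w, hw⟩
      have hw' := hw
      rw [hball] at hw'
      obtain ⟨x, hx, rfl⟩ := hw'
      exact ⟨⟨x, hx⟩, rfl⟩
  let e := Equiv.ofBijective f hf
  refine ⟨e.symm, ?_, ?_⟩
  · rw [Equiv.symm_apply_eq]
    apply Subtype.ext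
    change v = σ (1 : K)⁻¹ v
    rw [inv_one, hv.one_apply h1]
  · intro s x y
    obtain ⟨x, rfl⟩ := e.surjective x
    obtain ⟨y, rfl⟩ := e.surjective y
    simp only [Equiv.symm_apply_apply]
    change σ (y : K)⁻¹ v = σ (s : K)⁻¹ (σ (x : K)⁻¹ v) ↔ (y : K) = x * s
    rw [← (hv _ (hS s s.2) _ (hE' x x.2)).1, ← mul_inv_rev]
    constructor
    · intro h
      exact inv_injective ((hv _ (hE' y y.2) _ (hE _ (mem_cayleyGraph_ball_succ x.2 s.2))).2 h)
    · intro h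
      rw [h]

end Cayley

theorem HasPermApprox.isSoficFG {K : Type*} [Group K] (hK : HasPermApprox K) : IsSoficFG K := by
  classical
  intro S _ r hr
  set E : Finset K := (finite_cayleyGraph_ball S (r + 1)).toFinset⁻¹ ∪ S⁻¹ with hEdef
  have hr0 : (0 : ℝ) < r := by exact_mod_cast hr
  -- Half of `1 / r`, because an approximation demands a strict inequality.
  obtain ⟨V, hV, hV', σ, hσ⟩ := hK E (1 / (2 * r)) (by positivity)
  have := Fintype.ofFinite V
  refine ⟨V, this, permGraph σ S, {v | ¬ IsGoodAt σ E v}ᶜ.toFinset, ?_, ?_⟩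
  · have h1 : density {v | ¬ IsGoodAt σ E v} < 1 / r := by
      refine hσ.trans_lt ?_
      rw [div_lt_div_iff₀ (by positivity) hr0]
      linarith
    rw [density_lt_iff_ncard_compl] at h1
    rw [← Nat.card_eq_fintype_card, ← Set.ncard_eq_toFinset_card']
    exact h1
  · intro p hp
    refine ⟨1, permGraph_nbhdIso (E := E) ?_ ?_ ?_⟩
    · intro x hx
      apply Finset.mem_union_left
      simpa using hx
    · intro s hs
      apply Finset.mem_union_right
      simpa using hs
    · simpa using hp

theorem HasPermApprox.isSofic {G : Type*} [Group G] (hG : HasPermApprox G) : IsSofic G :=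
  fun K _ => (hG.of_injective K.subtype K.subtype_injective).isSoficFG

/-- The edge labels at a vertex whose neighborhood looks like the Cayley graph are group
multiplications, as seen through the isomorphism. -/
theorem LabeledGraph.NbhdIso.exists_chart {K V : Type*} [Group K] {S : Finset K} {r : ℕ}
    {A : LabeledGraph S V} {v : V} {q : K} (h : LabeledGraph.NbhdIso r A v (cayleyGraph S) q) :
    ∃ f : V → K, f v = 1 ∧ Set.InjOn f (A.ball v r) ∧
      (∀ x ∈ A.ball v r, ∀ y ∈ A.ball v r, ∀ s : S, A.edge s x y ↔ f y = f x * s) ∧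
      ∀ g ∈ (cayleyGraph S).ball q r, ∃ x ∈ A.ball v r, f x = q⁻¹ * g := by
  classical
  obtain ⟨f, hf, he⟩ := h
  refine ⟨fun x => if hx : x ∈ A.ball v r then q⁻¹ * (f ⟨x, hx⟩ : K) else 1, ?_, ?_, ?_, ?_⟩
  · simp [A.mem_ball_self v r, hf]
  · intro x hx y hy hxy
    simp only [hx, hy, dif_pos] at hxy
    have := f.injective (Subtype.ext (mul_left_cancel hxy))
    exact congrArg Subtype.val this
  · intro x hx y hy s
    rw [he s ⟨x, hx⟩ ⟨y, hy⟩]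
    simp only [hx, hy, dif_pos, mul_assoc, mul_right_inj]
    rfl
  · intro g hg
    refine ⟨f.symm ⟨g, hg⟩, (f.symm ⟨g, hg⟩).2, ?_⟩
    simp

theorem LabeledGraph.NbhdIso.exists_edge {K V : Type*} [Group K] {S : Finset K} {r : ℕ}
    {A : LabeledGraph S V} {v : V} {q : K} (h : LabeledGraph.NbhdIso r A v (cayleyGraph S) q)
    (hr : 1 ≤ r) (s : S) : ∃ w, A.edge s v w := by
  obtain ⟨f, hf, hinj, hedge, hsurj⟩ := h.exists_chart
  obtain ⟨w, hw, hw'⟩ := hsurj (q * s) <| LabeledGraph.ball_mono _ _ hr <|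
    LabeledGraph.mem_ball_succ_of_edge (n := 0) _ (x := q) rfl (l := s) rfl
  refine ⟨w, (hedge v (A.mem_ball_self _ _) w hw s).2 ?_⟩
  simp [hw', hf]

theorem LabeledGraph.NbhdIso.edge_source_unique {K V : Type*} [Group K] {S : Finset K} {r : ℕ}
    {A : LabeledGraph S V} {v : V} {q : K} (h : LabeledGraph.NbhdIso r A v (cayleyGraph S) q)
    (hr : 2 ≤ r) {s : S} {v' w : V} (h1 : A.edge s v w) (h2 : A.edge s v' w) : v = v' := by
  obtain ⟨f, hf, hinj, hedge, -⟩ := h.exists_chart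
  have hw1 : w ∈ A.ball v 1 := LabeledGraph.mem_ball_succ_of_edge (n := 0) _ (x := v) rfl h1
  have hw : w ∈ A.ball v r := LabeledGraph.ball_mono _ _ (by omega) hw1
  have hv : v ∈ A.ball v r := A.mem_ball_self _ _
  have hv' : v' ∈ A.ball v r := LabeledGraph.ball_mono _ _ hr (Or.inr ⟨w, hw1, s, Or.inr h2⟩)
  apply hinj hv hv'
  have e1 := (hedge v hv w hw s).1 h1
  have e2 := (hedge v' hv' w hw s).1 h2
  rw [e1] at e2
  exact mul_right_cancel e2

theorem exists_perm_extending {V : Type*} [Finite V] (W : Set V) (f : V → V)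
    (hf : Set.InjOn f W) : ∃ σ : Equiv.Perm V, ∀ v ∈ W, σ v = f v := by
  classical
  have := Fintype.ofFinite V
  obtain ⟨g, hg⟩ := Set.MapsTo.exists_equiv_extend_of_card_eq (t := (Finset.univ : Finset V))
    (Finset.card_univ).symm (s := W) (f := f) (fun _ _ => by simp) hf
  exact ⟨g.trans (Equiv.subtypeUnivEquiv (by simp)), fun v hv => hg v hv⟩

/-- With generating set `T * T` the products of two elements of `T` are themselves edge labels, so
multiplicativity can be read off within distance two. The permutation of `x` follows the edges
labeled `x⁻¹`. -/
theorem IsSoficFG.exists_permApprox {K : Type*} [Group K] (hK : IsSoficFG K) {T : Finset K}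
    (hT1 : 1 ∈ T) (hTinv : ∀ x ∈ T, x⁻¹ ∈ T) (hTgen : Subgroup.closure (T : Set K) = ⊤)
    {ε : ℝ} (hε : 0 < ε) : ∃ (V : Type) (_ : Finite V) (_ : Nonempty V)
      (σ : K → Equiv.Perm V), density {v | ¬ IsGoodAt σ T v} ≤ ε := by
  classical
  set S : Finset K := T * T with hS
  have hTS : T ⊆ S := Finset.subset_mul_right T hT1
  have hSgen : IsSymmGen S := by
    refine ⟨fun s hs => ?_, ?_⟩
    · obtain ⟨a, ha, b, hb, rfl⟩ := Finset.mem_mul.1 hs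
      rw [mul_inv_rev]
      exact Finset.mul_mem_mul (hTinv b hb) (hTinv a ha)
    · rw [eq_top_iff, ← hTgen]
      exact Subgroup.closure_mono (by exact_mod_cast hTS)
  -- A point `v` is good once `v` and all `σ b v` with `b ∈ T` lie in `W`, so at most `1 + T.card`
  -- sets of density below `1 / r` are lost.
  obtain ⟨r, hr⟩ := exists_nat_gt (max 2 ((1 + T.card) / ε))
  have hr2 : (2 : ℝ) < r := (le_max_left _ _).trans_lt hr
  have hr2' : 2 ≤ r := by exact_mod_cast hr2.le
  have hrε : (1 + T.card : ℝ) / r ≤ ε := by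
    rw [div_le_iff₀ (by linarith)]
    have := (le_max_right _ _).trans_lt hr
    rw [div_lt_iff₀ hε] at this
    linarith
  obtain ⟨V, hV, A, W, hW, hiso⟩ := hK S hSgen r (by omega)
  have hne : Nonempty V := by
    by_contra hne
    rw [not_nonempty_iff] at hne
    have : W = ∅ := Finset.eq_empty_of_isEmpty W
    simp [this] at hW
  have hWd : density (W : Set V)ᶜ < 1 / r := by
    rw [density_lt_iff_ncard_compl, compl_compl, Set.ncard_coe_finset, Nat.card_eq_fintype_card]
    exact hW
  have hex : ∀ s : S, ∃ σ : Equiv.Perm V, ∀ v ∈ W, A.edge s v (σ v) := by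
    intro s
    have h1 : ∀ v, ∃ w, v ∈ W → A.edge s v w := by
      intro v
      by_cases hv : v ∈ W
      · obtain ⟨q, hq⟩ := hiso v hv
        obtain ⟨w, hw⟩ := hq.exists_edge (by omega) s
        exact ⟨w, fun _ => hw⟩
      · exact ⟨v, fun h => absurd h hv⟩
    choose f hf using h1
    obtain ⟨σ, hσ⟩ := exists_perm_extending (W : Set V) f (by
      intro v hv v' hv' h
      obtain ⟨q, hq⟩ := hiso v hv
      refine hq.edge_source_unique hr2' (hf v hv) ?_
      rw [h]
      exact hf v' hv')
    exact ⟨σ, fun v hv => by rw [hσ v hv]; exact hf v hv⟩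
  choose τ hτ using hex
  let σ : K → Equiv.Perm V := fun x => if hx : x⁻¹ ∈ S then τ ⟨x⁻¹, hx⟩ else 1
  have hσ : ∀ x (hx : x⁻¹ ∈ S), ∀ v ∈ W, A.edge ⟨x⁻¹, hx⟩ v (σ x v) := by
    intro x hx v hv
    simp only [σ, hx, dif_pos]
    exact hτ _ v hv
  refine ⟨V, inferInstance, hne, σ, ?_⟩
  have hsub : {v | ¬ IsGoodAt σ T v} ⊆ (W : Set V)ᶜ ∪ ⋃ b ∈ T, (σ b) ⁻¹' (W : Set V)ᶜ := by
    intro v hv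
    by_contra hcon
    simp only [Set.mem_union, Set.mem_compl_iff, Set.mem_iUnion, Set.mem_preimage, not_or,
      not_exists, not_not] at hcon
    obtain ⟨hvW, hvW'⟩ := hcon
    obtain ⟨q, hq⟩ := hiso v hvW
    obtain ⟨f, hf, hinj, hedge, -⟩ := hq.exists_chart
    have hmem : ∀ x, x⁻¹ ∈ S → σ x v ∈ A.ball v 1 := fun x hx =>
      LabeledGraph.mem_ball_succ_of_edge (n := 0) _ (x := v) rfl (hσ x hx v hvW)
    have hmem' : ∀ x, x⁻¹ ∈ S → σ x v ∈ A.ball v r := fun x hx =>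
      LabeledGraph.ball_mono _ _ (by omega) (hmem x hx)
    have hval : ∀ x, x⁻¹ ∈ S → f (σ x v) = x⁻¹ := by
      intro x hx
      rw [(hedge v (A.mem_ball_self _ _) _ (hmem' x hx) ⟨x⁻¹, hx⟩).1 (hσ x hx v hvW), hf, one_mul]
    refine hv fun a ha b hb => ⟨?_, ?_⟩
    · have ha' := hTS (hTinv a ha)
      have hb' := hTS (hTinv b hb)
      have hab : (a * b)⁻¹ ∈ S := by
        rw [mul_inv_rev]
        exact Finset.mul_mem_mul (hTinv b hb) (hTinv a ha)
      have he := hσ a ha' _ (hvW' b hb)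
      have hm : σ a (σ b v) ∈ A.ball v r := LabeledGraph.ball_mono _ _ hr2'
        (LabeledGraph.mem_ball_succ_of_edge _ (hmem b hb') he)
      apply hinj (hmem' _ hab) hm
      rw [hval _ hab, (hedge _ (hmem' b hb') _ hm _).1 he, hval b hb', mul_inv_rev]
    · intro h
      have := congrArg f h
      rw [hval a (hTS (hTinv a ha)), hval b (hTS (hTinv b hb))] at this
      exact inv_injective this
  refine (density_mono hsub).trans ((density_union_le _ _).trans ?_)
  have hsum : ∑ b ∈ T, density (σ b ⁻¹' (W : Set V)ᶜ) ≤ T.card * (1 / (r : ℝ)) := by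
    refine (Finset.sum_le_sum fun b _ => ?_ : _ ≤ ∑ b ∈ T, (1 / (r : ℝ))).trans (by simp)
    rw [density_preimage]
    exact hWd.le
  refine le_trans (add_le_add hWd.le ((density_biUnion_le _ _).trans hsum)) (le_trans ?_ hrε)
  rw [add_div, mul_one_div]

theorem IsSofic.hasPermApprox {G : Type*} [Group G] (hG : IsSofic G) : HasPermApprox G := by
  classical
  intro E ε hε
  set T : Finset G := {1} ∪ (E ∪ E⁻¹) with hT
  have hTE : E ⊆ T := fun x hx => by simp [hT, hx]
  set K := Subgroup.closure (T : Set G) with hK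
  have hTK : ∀ x ∈ T, x ∈ K := fun x hx => Subgroup.subset_closure hx
  set T' : Finset K := T.subtype (· ∈ K) with hT'
  have hmem : ∀ x : K, x ∈ T' ↔ (x : G) ∈ T := fun x => by simp [hT']
  obtain ⟨V, hV, hV', σ, hσ⟩ := (hG K ⟨T, rfl⟩).exists_permApprox (T := T')
    (by rw [hmem]; simp [hT])
    (by
      intro x hx
      rw [hmem] at hx ⊢
      simp only [hT, Finset.mem_union, Finset.mem_singleton, Finset.mem_inv', inv_inv,
        Subgroup.coe_inv, inv_eq_one] at hx ⊢
      tauto)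
    (by
      have h2 : (T' : Set K) = ((↑) : K → G) ⁻¹' (T : Set G) := by ext x; simp [hmem]
      rw [h2]
      exact Subgroup.closure_closure_coe_preimage) hε
  refine ⟨V, hV, hV', fun x => if hx : x ∈ K then σ ⟨x, hx⟩ else 1,
    (density_mono ?_).trans hσ⟩
  intro v hv hgood
  refine hv fun a ha b hb => ?_
  have haK := hTK a (hTE ha)
  have hbK := hTK b (hTE hb)
  have := hgood ⟨a, haK⟩ ((hmem _).2 (hTE ha)) ⟨b, hbK⟩ ((hmem _).2 (hTE hb))
  simp only [haK, hbK, mul_mem haK hbK, dif_pos]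
  exact ⟨this.1, fun h => congrArg Subtype.val (this.2 h)⟩

/-! ### Følner sets -/

/-- The endpoint of a path in a spanned subgraph of the Cayley graph. -/
theorem LabeledGraph.NbhdIso.mul_mem_of_mem_ball {K : Type*} [Group K] {S : Finset K} {r : ℕ}
    {F : Set K} {p : F} {q : K}
    (h : LabeledGraph.NbhdIso r ((cayleyGraph S).induce F) p (cayleyGraph S) q) {n : ℕ}
    (hn : n ≤ r) {g : K} (hg : g ∈ (cayleyGraph S).ball 1 n) : (p : K) * g ∈ F := by
  obtain ⟨f, hf, he⟩ := h
  -- Strengthened for the induction: the inverse isomorphism sends `q * g` to `p * g`.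
  suffices ∀ n, ∀ hn : n ≤ r, ∀ g ∈ (cayleyGraph S).ball 1 n,
      ∃ hg : q * g ∈ (cayleyGraph S).ball q n,
      ((f.symm ⟨q * g, LabeledGraph.ball_mono _ _ hn hg⟩ : F) : K) = p * g by
    obtain ⟨hg', h⟩ := this n hn g hg
    rw [← h]
    exact (f.symm ⟨q * g, _⟩ : F).2
  clear hn hg g n
  intro n
  induction n with
  | zero =>
    rintro hn g rfl
    refine ⟨by rw [mul_one]; exact LabeledGraph.mem_ball_self _ _ _, ?_⟩
    simp only [mul_one]
    have : f.symm ⟨q, LabeledGraph.mem_ball_self _ _ _⟩ = ⟨p, LabeledGraph.mem_ball_self _ _ _⟩ := by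
      rw [Equiv.symm_apply_eq, hf]
    rw [this]
  | succ n ih =>
    rintro hn g (hg | ⟨x, hx, s, hs | hs⟩)
    · obtain ⟨h1, h2⟩ := ih (by omega) g hg
      exact ⟨Or.inl h1, h2⟩
    · obtain ⟨h1, h2⟩ := ih (by omega) x hx
      change g = x * s at hs
      subst hs
      have h3 : q * (x * s) ∈ (cayleyGraph S).ball q (n + 1) :=
        Or.inr ⟨_, h1, s, Or.inl (mul_assoc _ _ _).symm⟩
      refine ⟨h3, ?_⟩
      have h4 := (he s (f.symm ⟨q * x, LabeledGraph.ball_mono _ _ (by omega) h1⟩)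
        (f.symm ⟨q * (x * s), LabeledGraph.ball_mono _ _ hn h3⟩)).2
        (by simp only [Equiv.apply_symm_apply]; exact (mul_assoc _ _ _).symm)
      change ((f.symm _ : F) : K) = ((f.symm _ : F) : K) * s at h4
      rw [h4, h2, mul_assoc]
    · obtain ⟨h1, h2⟩ := ih (by omega) x hx
      change x = g * s at hs
      subst hs
      have h3 : q * g ∈ (cayleyGraph S).ball q (n + 1) :=
        Or.inr ⟨_, h1, s, Or.inr (mul_assoc _ _ _).symm⟩
      refine ⟨h3, ?_⟩
      have h4 := (he s (f.symm ⟨q * g, LabeledGraph.ball_mono _ _ hn h3⟩)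
        (f.symm ⟨q * (g * s), LabeledGraph.ball_mono _ _ (by omega) h1⟩)).2
        (by simp only [Equiv.apply_symm_apply]; exact (mul_assoc _ _ _).symm)
      change ((f.symm _ : F) : K) = ((f.symm _ : F) : K) * s at h4
      rw [h2, ← mul_assoc] at h4
      exact (mul_right_cancel h4).symm

theorem IsSymmGen.exists_mem_ball {K : Type*} [Group K] {S : Finset K} (hS : IsSymmGen S) (g : K) :
    ∃ n, g ∈ (cayleyGraph S).ball 1 n := by
  have hg : g ∈ Subgroup.closure (S : Set K) := by rw [hS.2]; trivial
  induction hg using Subgroup.closure_induction_right with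
  | one => exact ⟨0, rfl⟩
  | mul_right x _ y hy ih =>
    obtain ⟨n, hn⟩ := ih
    exact ⟨n + 1, mem_cayleyGraph_ball_succ hn hy⟩
  | mul_inv_cancel x _ y hy ih =>
    obtain ⟨n, hn⟩ := ih
    exact ⟨n + 1, mem_cayleyGraph_ball_succ' hn hy⟩

theorem IsSymmGen.exists_subset_ball {K : Type*} [Group K] {S : Finset K} (hS : IsSymmGen S)
    (B : Finset K) : ∃ n, (B : Set K) ⊆ (cayleyGraph S).ball 1 n := by
  choose n hn using hS.exists_mem_ball
  exact ⟨B.sup n, fun b hb => LabeledGraph.ball_mono _ _ (Finset.le_sup hb) (hn b)⟩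

/-- From a point of `W` paths of length at most `r` do not leave `F`. Once `r` exceeds the word
lengths in `B` and `1 / δ`, only points outside `W` can be moved out. -/
theorem IsAmenableFG.exists_right_folner {K : Type*} [Group K] [DecidableEq K]
    (hK : IsAmenableFG K) (B : Finset K) {δ : ℝ} (hδ : 0 < δ) :
    ∃ F : Finset K, F.Nonempty ∧
      ∀ b ∈ B, ((F.filter fun f => f * b ∉ F).card : ℝ) ≤ δ * F.card := by
  classical
  obtain ⟨S, hS, F, hF⟩ := hK
  obtain ⟨n, hn⟩ := hS.exists_subset_ball B
  obtain ⟨r, hr⟩ := exists_nat_gt (max (n + 1 : ℝ) (1 / δ))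
  have hr1 : n + 1 < r := by exact_mod_cast (le_max_left _ _).trans_lt hr
  have hr0 : (0 : ℝ) < r := by exact_mod_cast (by omega : 0 < r)
  have hrδ : 1 / (r : ℝ) ≤ δ := by
    rw [one_div_le hr0 hδ]
    exact ((le_max_right _ _).trans_lt hr).le
  obtain ⟨m, W, hW, hiso⟩ := (hF r (by omega)).exists
  have hcard : Fintype.card (F m : Set K) = (F m).card := by simp
  rw [hcard] at hW
  refine ⟨F m, ?_, fun b hb => ?_⟩
  · rw [Finset.nonempty_iff_ne_empty]
    intro h
    have h1 := Finset.card_le_univ W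
    rw [hcard] at h1
    rw [Finset.card_eq_zero.2 h] at h1 hW
    have : (W.card : ℝ) ≤ 0 := by exact_mod_cast h1
    simp only [Nat.cast_zero, mul_zero] at hW
    linarith
  · have hsub : (F m).filter (fun f => f * b ∉ F m) ⊆ F m \ W.map (Function.Embedding.subtype _) := by
      intro f hf
      rw [Finset.mem_filter] at hf
      rw [Finset.mem_sdiff]
      refine ⟨hf.1, fun h => hf.2 ?_⟩
      obtain ⟨p, hp, rfl⟩ := Finset.mem_map.1 h
      obtain ⟨q, hq⟩ := hiso p hp
      exact hq.mul_mem_of_mem_ball (by omega : n ≤ r) (hn hb)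
    have h1 := Finset.card_le_card hsub
    have hWF : W.map (Function.Embedding.subtype _) ⊆ F m := by
      intro f hf
      obtain ⟨p, hp, rfl⟩ := Finset.mem_map.1 hf
      exact p.2
    have h2 := Finset.card_sdiff_add_card_eq_card hWF
    rw [Finset.card_map] at h2
    have h3 : ((F m \ W.map (Function.Embedding.subtype _)).card : ℝ) + W.card = (F m).card := by
      exact_mod_cast h2
    have h4 : (((F m).filter fun f => f * b ∉ F m).card : ℝ) ≤
      (F m \ W.map (Function.Embedding.subtype _)).card := by exact_mod_cast h1
    have h5 : (1 / (r : ℝ)) * (F m).card ≤ δ * (F m).card := by gcongr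
    linarith

/-- Inversion turns right Følner sets of the subgroup generated by `B` into left ones. -/
theorem IsAmenable.exists_folner {Λ : Type*} [Group Λ] [DecidableEq Λ] (hΛ : IsAmenable Λ)
    (B : Finset Λ) {δ : ℝ} (hδ : 0 < δ) :
    ∃ F : Finset Λ, F.Nonempty ∧ ∀ b ∈ B,
      ((F.filter fun f => b * f ∉ F).card : ℝ) ≤ δ * F.card ∧
      ((F.filter fun f => b⁻¹ * f ∉ F).card : ℝ) ≤ δ * F.card := by
  classical
  set K := Subgroup.closure (B : Set Λ) with hK
  have hBK : ∀ b ∈ B, b ∈ K := fun b hb => Subgroup.subset_closure hb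
  obtain ⟨F, hF, h⟩ := (hΛ K ⟨B, rfl⟩).exists_right_folner
    (B.subtype (· ∈ K) ∪ (B.subtype (· ∈ K))⁻¹) hδ
  let j : K ↪ Λ := ⟨fun x => (x : Λ)⁻¹, fun x y h => Subtype.ext (inv_injective h)⟩
  have key : ∀ b : K, ((F.filter fun f => f * b ∉ F).card : ℝ) ≤ δ * F.card →
      (((F.map j).filter fun f => (b : Λ)⁻¹ * f ∉ F.map j).card : ℝ) ≤ δ * (F.map j).card := by
    intro b hb
    have : (F.map j).filter (fun f => (b : Λ)⁻¹ * f ∉ F.map j) =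
        (F.filter fun f => f * b ∉ F).map j := by
      rw [Finset.filter_map]
      congr 1
      apply Finset.filter_congr
      intro f hf
      have : (b : Λ)⁻¹ * j f = j (f * b) := (mul_inv_rev (f : Λ) b).symm
      rw [Function.comp_apply, this, Finset.mem_map']
    rw [this, Finset.card_map, Finset.card_map]
    exact hb
  refine ⟨F.map j, hF.map, fun b hb => ⟨?_, ?_⟩⟩
  · have := key ⟨b, hBK b hb⟩⁻¹ (h _ (by simp [hb]))
    simpa using this
  · exact key ⟨b, hBK b hb⟩ (h _ (by simp [hb]))

/-- Almost equivariant position functions with finite range exist on suitable approximations of a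
group `A`: after adding a random enumeration `u` of the points, `t x` is the element `f` of the
Følner set `F` for which the enumeration is minimal at `f⁻¹ x`, and `c x` is the point `f⁻¹ x`. -/
theorem exists_equivariant_position {A Λ : Type*} [Group A] [Group Λ] [DecidableEq Λ]
    (hA : HasPermApprox A) (ι : Λ →* A) (hι : Function.Injective ι) (F B : Finset Λ)
    (hF : F.Nonempty) {δ : ℝ}
    (hδ : ∀ b ∈ B, ((F.filter fun f => b * f ∉ F).card : ℝ) ≤ δ * F.card ∧
      ((F.filter fun f => b⁻¹ * f ∉ F).card : ℝ) ≤ δ * F.card)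
    (E : Finset A) {ε : ℝ} (hε : 0 < ε) :
    ∃ (X : Type) (_ : Finite X) (_ : Nonempty X) (σ : A → Equiv.Perm X) (t : X → Λ) (c : X → X),
      (∀ x, t x ∈ F) ∧ density {x | ¬ IsGoodAt σ E x} ≤ ε ∧
      (∀ b ∈ B, density {x | ¬ (t (σ (ι b) x) = b * t x ∧ c (σ (ι b) x) = c x)} ≤ 2 * δ + ε) ∧
      ∀ a ∈ E, a ∉ Set.range ι → density {x | c (σ a x) = c x} ≤ ε := by
  classical
  set T₀ : Finset A := {1} ∪ (F.image ι ∪ (B.image ι ∪ E)) with hT₀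
  set T : Finset A := T₀ ∪ T₀⁻¹ with hT
  set E₀ : Finset A := T * T with hE₀
  have hT1 : (1 : A) ∈ T := by simp [hT, hT₀]
  have hTE₀ : T ⊆ E₀ := Finset.subset_mul_right T hT1
  have hFT : ∀ f ∈ F, ι f ∈ T := fun f hf => by
    simp only [hT, hT₀, Finset.mem_union]
    exact Or.inl (Or.inr (Or.inl (Finset.mem_image_of_mem _ hf)))
  have hBT : ∀ b ∈ B, ι b ∈ T := fun f hf => by
    simp only [hT, hT₀, Finset.mem_union]
    exact Or.inl (Or.inr (Or.inr (Or.inl (Finset.mem_image_of_mem _ hf))))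
  have hET : ∀ a ∈ E, a ∈ T := fun f hf => by
    simp only [hT, hT₀, Finset.mem_union]
    exact Or.inl (Or.inr (Or.inr (Or.inr hf)))
  have hTinv : ∀ a ∈ T, a⁻¹ ∈ T := fun a ha => by
    simp only [hT, Finset.mem_union, Finset.mem_inv', inv_inv] at ha ⊢
    tauto
  have hTmul : ∀ a ∈ T, ∀ b ∈ T, a⁻¹ * b ∈ E₀ := fun a ha b hb =>
    Finset.mul_mem_mul (hTinv a ha) hb
  obtain ⟨V, hV, hV', σ, hσ⟩ := hA E₀ ε hε
  let U := V ≃ Fin (Nat.card V)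
  have hU : Nonempty U := ⟨Finite.equivFin V⟩
  have hgood : ∀ v, IsGoodAt σ E₀ v → ∀ a ∈ T, ∀ b ∈ T, (σ a)⁻¹ (σ b v) = σ (a⁻¹ * b) v :=
    fun v hv a ha b hb => hv.inv_apply (hTE₀ ha) (hTmul a ha b hb)
  have hgood' : ∀ v, IsGoodAt σ E₀ v → ∀ a ∈ T, (σ a)⁻¹ v = σ a⁻¹ v := by
    intro v hv a ha
    have := hgood v hv a ha 1 hT1
    rwa [hv.one_apply (hTE₀ hT1), mul_one] at this
  have hmin : ∀ p : V × U, ∃ f ∈ F, ∀ f' ∈ F, p.2 ((σ (ι f))⁻¹ p.1) ≤ p.2 ((σ (ι f'))⁻¹ p.1) :=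
    fun p => Finset.exists_min_image F (fun f => p.2 ((σ (ι f))⁻¹ p.1)) hF
  choose t htF ht using hmin
  -- The enumeration becomes a coordinate on which the group acts trivially, so densities average
  -- over it.
  refine ⟨V × U, inferInstance, inferInstance, fun a => (σ a).prodCongr (Equiv.refl U), t,
    fun p => ((σ (ι (t p)))⁻¹ p.1, p.2), htF, ?_, ?_, ?_⟩
  · refine le_trans (density_mono ?_) ((density_preimage_fst_le {v | ¬ IsGoodAt σ E₀ v}).trans hσ)
    rintro ⟨v, u⟩ hv hgv
    refine hv fun a ha b hb => ?_
    obtain ⟨h1, h2⟩ := hgv a (hTE₀ (hET a ha)) b (hTE₀ (hET b hb))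
    simp [h1]
    exact fun h => h2 h
  · intro b hb
    obtain ⟨hδ1, hδ2⟩ := hδ b hb
    have hcard : (0 : ℝ) < F.card := by exact_mod_cast hF.card_pos
    have hδ0 : 0 ≤ δ := by
      by_contra! h
      have : δ * F.card < 0 := mul_neg_of_neg_of_pos h hcard
      have h3 : (0 : ℝ) ≤ ((F.filter fun f => b * f ∉ F).card : ℝ) := by positivity
      linarith
    -- The candidates `P f` for `v` and `Q f` for its translate by `b` satisfy `Q (b * f) = P f`, so
    -- the two candidate sets differ only through the Følner boundary, collected in `I`. If the
    -- minimum over their union avoids `I`, it is the minimum for both points, and `t` and `c`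
    -- behave equivariantly.
    have hfib : ∀ v, IsGoodAt σ E₀ v → density {u : U |
        ¬ (t (σ (ι b) v, u) = b * t (v, u) ∧
          (σ (ι (t (σ (ι b) v, u))))⁻¹ (σ (ι b) v) = (σ (ι (t (v, u))))⁻¹ v)} ≤ 2 * δ := by
      intro v hv
      have hP : ∀ f ∈ F, (σ (ι f))⁻¹ v = σ (ι f)⁻¹ v := fun f hf => hgood' v hv _ (hFT f hf)
      have hQ : ∀ f ∈ F, (σ (ι f))⁻¹ (σ (ι b) v) = σ ((ι f)⁻¹ * ι b) v := fun f hf =>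
        hgood v hv _ (hFT f hf) _ (hBT b hb)
      set P : Λ → V := fun f => (σ (ι f))⁻¹ v with hPdef
      set Q : Λ → V := fun f => (σ (ι f))⁻¹ (σ (ι b) v) with hQdef
      have hPinj : ∀ f ∈ F, ∀ f' ∈ F, P f = P f' → f = f' := by
        intro f hf f' hf' h
        simp only [hPdef] at h
        rw [hP f hf, hP f' hf'] at h
        have := (hv _ (hTE₀ (hTinv _ (hFT f hf))) _ (hTE₀ (hTinv _ (hFT f' hf')))).2 h
        exact hι (inv_injective this)
      have hQinj : ∀ f ∈ F, ∀ f' ∈ F, Q f = Q f' → f = f' := by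
        intro f hf f' hf' h
        simp only [hQdef] at h
        rw [hQ f hf, hQ f' hf'] at h
        have := (hv _ (hTmul _ (hFT f hf) _ (hBT b hb)) _ (hTmul _ (hFT f' hf') _ (hBT b hb))).2 h
        exact hι (inv_injective (mul_right_cancel this))
      have hPQ : ∀ f ∈ F, b * f ∈ F → Q (b * f) = P f := by
        intro f hf hbf
        simp only [hPdef, hQdef]
        rw [hQ _ hbf, hP f hf]
        simp
      set A' : Finset V := F.image P ∪ F.image Q with hA'
      set I : Finset V := (F.filter fun f => b * f ∉ F).image P ∪
        (F.filter fun f => b⁻¹ * f ∉ F).image Q with hI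
      have hIA : I ⊆ A' := Finset.union_subset_union
        (Finset.image_subset_image (Finset.filter_subset _ _))
        (Finset.image_subset_image (Finset.filter_subset _ _))
      have hA'card : F.card ≤ A'.card := by
        rw [← Finset.card_image_of_injOn (s := F) (f := P) hPinj]
        exact Finset.card_le_card Finset.subset_union_left
      have hA'card' : (F.card : ℝ) ≤ A'.card := by exact_mod_cast hA'card
      have hIcard : (I.card : ℝ) ≤ 2 * δ * F.card := by
        have h1 : I.card ≤ (F.filter fun f => b * f ∉ F).card +
            (F.filter fun f => b⁻¹ * f ∉ F).card :=
          (Finset.card_union_le _ _).trans (add_le_add Finset.card_image_le Finset.card_image_le)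
        have h2 : (I.card : ℝ) ≤ (F.filter fun f => b * f ∉ F).card +
            (F.filter fun f => b⁻¹ * f ∉ F).card := by exact_mod_cast h1
        linarith
      have hdens := density_argmin_mem_le (n := Nat.card V) A' I hIA
      have hle : (I.card : ℝ) / A'.card ≤ 2 * δ := by
        apply div_le_of_le_mul₀ (by positivity) (by positivity)
        refine hIcard.trans ?_
        gcongr
      refine (density_mono ?_).trans (hdens.trans hle)
      intro u hu
      obtain ⟨m, hm, hmmin⟩ := Finset.exists_min_image A' u
        ((hF.image P).mono Finset.subset_union_left)
      by_cases hmI : m ∈ I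
      · exact ⟨m, hmI, hmmin⟩
      exfalso
      obtain ⟨f, hf, hbf, rfl⟩ : ∃ f ∈ F, b * f ∈ F ∧ P f = m := by
        rcases Finset.mem_union.1 hm with hm | hm
        · obtain ⟨f, hf, rfl⟩ := Finset.mem_image.1 hm
          refine ⟨f, hf, ?_, rfl⟩
          by_contra hbf
          exact hmI (Finset.mem_union_left _
            (Finset.mem_image_of_mem _ (Finset.mem_filter.2 ⟨hf, hbf⟩)))
        · obtain ⟨f, hf, rfl⟩ := Finset.mem_image.1 hm
          have hbf : b⁻¹ * f ∈ F := by
            by_contra hbf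
            exact hmI (Finset.mem_union_right _
              (Finset.mem_image_of_mem _ (Finset.mem_filter.2 ⟨hf, hbf⟩)))
          refine ⟨b⁻¹ * f, hbf, by simpa using hf, ?_⟩
          rw [← hPQ _ hbf (by simpa using hf), mul_inv_cancel_left]
      have h1 : t (v, u) = f := by
        refine hPinj _ (htF _) _ hf (u.injective (le_antisymm (ht (v, u) f hf) ?_))
        exact hmmin _ (Finset.mem_union_left _ (Finset.mem_image_of_mem _ (htF _)))
      have h2 : t (σ (ι b) v, u) = b * f := by
        refine hQinj _ (htF _) _ hbf (u.injective (le_antisymm (ht (σ (ι b) v, u) _ hbf) ?_))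
        change u (Q (b * f)) ≤ _
        rw [hPQ f hf hbf]
        exact hmmin _ (Finset.mem_union_right _ (Finset.mem_image_of_mem _ (htF _)))
      refine hu ⟨by rw [h1, h2], ?_⟩
      rw [h1, h2]
      exact hPQ f hf hbf
    have hsub : {x : V × U | ¬ (t ((σ (ι b)).prodCongr (Equiv.refl U) x) = b * t x ∧
        ((σ (ι (t ((σ (ι b)).prodCongr (Equiv.refl U) x))))⁻¹
          ((σ (ι b)).prodCongr (Equiv.refl U) x).1, ((σ (ι b)).prodCongr (Equiv.refl U) x).2) =
        ((σ (ι (t x)))⁻¹ x.1, x.2))} ⊆ (Prod.fst ⁻¹' {v | ¬ IsGoodAt σ E₀ v}) ∪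
        {x : V × U | IsGoodAt σ E₀ x.1 ∧ ¬ (t (σ (ι b) x.1, x.2) = b * t x ∧
          (σ (ι (t (σ (ι b) x.1, x.2))))⁻¹ (σ (ι b) x.1) = (σ (ι (t x)))⁻¹ x.1)} := by
      rintro ⟨v, u⟩ hx
      by_cases hv : IsGoodAt σ E₀ v
      · refine Or.inr ⟨hv, fun h => hx ⟨h.1, ?_⟩⟩
        exact Prod.ext h.2 rfl
      · exact Or.inl hv
    refine (density_mono hsub).trans ((density_union_le _ _).trans ?_)
    rw [add_comm]
    refine add_le_add (density_le_of_fiber (by positivity) fun v => ?_)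
      ((density_preimage_fst_le _).trans hσ)
    by_cases hv : IsGoodAt σ E₀ v
    · exact (density_mono fun u hu => hu.2).trans (hfib v hv)
    · simp only [hv, false_and, Set.mem_ofPred_eq, Set.ofPred_false, density_empty]
      positivity
  · intro a ha haι
    refine le_trans (density_mono ?_) ((density_preimage_fst_le {v | ¬ IsGoodAt σ E₀ v}).trans hσ)
    rintro ⟨v, u⟩ hx hv
    have hx1 := congrArg Prod.fst hx
    set f := t (v, u)
    set f' := t ((σ a).prodCongr (Equiv.refl U) (v, u))
    change (σ (ι f'))⁻¹ (σ a v) = (σ (ι f))⁻¹ v at hx1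
    have hf : ι f ∈ T := hFT _ (htF _)
    have hf' : ι f' ∈ T := hFT _ (htF _)
    rw [hgood v hv _ hf' _ (hET a ha), hgood' v hv _ hf] at hx1
    -- Freeness gives `(ι f')⁻¹ * a = (ι f)⁻¹`, which puts `a` in the range of `ι`.
    have h1 := (hv _ (hTmul _ hf' _ (hET a ha)) _ (hTE₀ (hTinv _ hf))).2 hx1
    refine haι ⟨f' * f⁻¹, ?_⟩
    rw [map_mul, map_inv, ← h1, mul_inv_cancel_left]

/-! ### Skew products -/

/-- The conjugate of `π × 1` by the map `(x, y) ↦ (x, ψ x y)`. -/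
def skewPerm {X Y : Type*} (ψ : X → Equiv.Perm Y) (π : Equiv.Perm X) : Equiv.Perm (X × Y) where
  toFun p := (π p.1, ψ (π p.1) ((ψ p.1)⁻¹ p.2))
  invFun p := (π⁻¹ p.1, ψ (π⁻¹ p.1) ((ψ p.1)⁻¹ p.2))
  left_inv p := by simp
  right_inv p := by simp

theorem skewPerm_apply {X Y : Type*} (ψ : X → Equiv.Perm Y) (π : Equiv.Perm X) (p : X × Y) :
    skewPerm ψ π p = (π p.1, ψ (π p.1) ((ψ p.1)⁻¹ p.2)) := rfl

theorem IsGoodAt.skewPerm {G X Y : Type*} [Group G] {σ : G → Equiv.Perm X} {E : Finset G}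
    {p : X × Y} (h : IsGoodAt σ E p.1) (ψ : X → Equiv.Perm Y) :
    IsGoodAt (fun a => skewPerm ψ (σ a)) E p := by
  intro a ha b hb
  obtain ⟨h1, h2⟩ := h a ha b hb
  refine ⟨?_, fun h => h2 (congrArg Prod.fst h)⟩
  simp [skewPerm_apply, h1]

/-- In the coordinates given by `e`, one compares `τ (ι (t (π x))) y` with `τ (ι b) (τ (ι (t x))
y)`. These agree when `t` is equivariant at `x` and `τ` is multiplicative at `y`. -/
theorem density_skewPerm_ne_le {X Y Λ H : Type*} [Finite X] [Finite Y] [Group Λ] [Group H]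
    (ι : Λ →* H) (τ : H → Equiv.Perm Y) (E : Finset H) (t : X → Λ) (ht : ∀ x, ι (t x) ∈ E)
    (π : Equiv.Perm X) {b : Λ} (hb : ι b ∈ E) :
    density {p : X × Y | skewPerm (fun x => τ (ι (t x))) π p ≠ (π p.1, τ (ι b) p.2)} ≤
      density {x | t (π x) ≠ b * t x} + density {y | ¬ IsGoodAt τ E y} := by
  let e : X × Y ≃ X × Y :=
    { toFun := fun p => (p.1, τ (ι (t p.1)) p.2)
      invFun := fun p => (p.1, (τ (ι (t p.1)))⁻¹ p.2)
      left_inv := fun p => by simp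
      right_inv := fun p => by simp }
  refine (density_le_of_preimage e (t := Prod.fst ⁻¹' {x | t (π x) ≠ b * t x} ∪
    Prod.snd ⁻¹' {y | ¬ IsGoodAt τ E y}) ?_).trans ((density_union_le _ _).trans
      (add_le_add (density_preimage_fst_le _) (density_preimage_snd_le _)))
  rintro ⟨x, y⟩ h
  by_contra hcon
  simp only [Set.mem_union, Set.mem_preimage, Set.mem_ofPred_eq, not_or, not_not] at hcon
  obtain ⟨h1, h2⟩ := hcon
  apply h
  change (π x, τ (ι (t (π x))) ((τ (ι (t x)))⁻¹ (τ (ι (t x)) y))) =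
    (π x, τ (ι b) (τ (ι (t x)) y))
  have hinv : (τ (ι (t x)))⁻¹ (τ (ι (t x)) y) = y := Equiv.symm_apply_apply _ _
  rw [hinv, h1, map_mul, (h2 _ hb _ (ht x)).1]

/-! ### Words acting on a skew product with a group of involutions -/

section Words
variable {L Z I K : Type*} [Group K]

/-- The list of the values of `κ` before and after each step of the action of a word. -/
def wordPath (π : L → Equiv.Perm Z) (κ : L → Z → I) : List L → Z → List I
  | [], _ => []
  | l :: w, z => κ l (π l ((w.map π).prod z)) :: κ l ((w.map π).prod z) :: wordPath π κ w z

theorem wordPath_length (π : L → Equiv.Perm Z) (κ : L → Z → I) (w : List L) (z : Z) :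
    (wordPath π κ w z).length = 2 * w.length := by
  induction w with
  | nil => rfl
  | cons l w ih => simp only [wordPath, List.length_cons, ih]; ring

/-- Each letter contributes the involution at its new value of `κ` times the inverse of the one at
its old value. The inverse can be dropped. -/
theorem prod_map_skewPerm_apply (π : L → Equiv.Perm Z) (κ : L → Z → I) {a : I → K}
    (ha : ∀ i, a i * a i = 1) (w : List L) (z : Z) (k : K) :
    (w.map fun l => skewPerm (fun z => Equiv.mulLeft (a (κ l z))) (π l)).prod (z, k) =
      ((w.map π).prod z, ((wordPath π κ w z).map a).prod * k) := by
  have hinv : ∀ i, (a i)⁻¹ = a i := fun i => inv_eq_of_mul_eq_one_left (ha i)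
  induction w with
  | nil => simp [wordPath]
  | cons l w ih =>
    simp only [List.map_cons, List.prod_cons, Equiv.Perm.mul_apply, ih, skewPerm_apply, wordPath]
    simp [hinv, mul_assoc]

/-- Neighbours within the pair of one letter differ by `hz`, neighbours from consecutive letters by
`hw`. -/
theorem wordPath_isChain (π : L → Equiv.Perm Z) (κ : L → Z → I) (w : List L) (z : Z)
    (hw : w.IsChain fun l m => ∀ x y, κ l x ≠ κ m y)
    (hz : ∀ l w', l :: w' <:+ w → κ l (π l ((w'.map π).prod z)) ≠ κ l ((w'.map π).prod z)) :
    (wordPath π κ w z).IsChain (· ≠ ·) := by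
  induction w with
  | nil => exact List.isChain_nil
  | cons l w ih =>
    have ih := ih hw.tail fun m w' h => hz m w' (h.trans (List.suffix_cons l w))
    refine List.isChain_cons_cons.2 ⟨hz l w List.suffix_rfl, ?_⟩
    cases w with
    | nil => exact List.isChain_singleton _
    | cons m w => exact List.isChain_cons_cons.2 ⟨(List.isChain_cons_cons.1 hw).1 _ _, ih⟩

/-- Union bound over the steps: the bad set of a letter is pulled back by the permutation of the
suffix after it, which preserves density. -/
theorem density_wordPath_le [Finite Z] (π : L → Equiv.Perm Z) (κ : L → Z → I) (w : List L) {ε : ℝ}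
    (hε : ∀ l ∈ w, density {z | κ l (π l z) = κ l z} ≤ ε) :
    density {z | ¬ ∀ l w', l :: w' <:+ w →
      κ l (π l ((w'.map π).prod z)) ≠ κ l ((w'.map π).prod z)} ≤ w.length * ε := by
  induction w with
  | nil => simp [density_empty]
  | cons m w ih =>
    have ih := ih fun l hl => hε l (List.mem_cons_of_mem _ hl)
    have hm := hε m List.mem_cons_self
    rw [← density_preimage (w.map π).prod] at hm
    refine (density_mono ?_).trans ((density_union_le _ _).trans (add_le_add hm ih)) |>.trans ?_
    · intro z hz
      by_contra hcon
      simp only [Set.mem_union, Set.mem_preimage, Set.mem_ofPred_eq, not_or, not_not] at hcon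
      refine hz fun l w' h => ?_
      rcases List.suffix_cons_iff.1 h with h | h
      · obtain ⟨rfl, rfl⟩ := List.cons.inj h
        exact hcon.1
      · exact hcon.2 l w' h
    · rw [List.length_cons]
      push_cast
      linarith

theorem density_fixed_word_le [Finite Z] [Finite K] (π : L → Equiv.Perm Z) (κ : L → Z → I)
    {a : I → K} (ha : ∀ i, a i * a i = 1) {w : List L} (hw0 : w ≠ [])
    (haw : ∀ l : List I, l ≠ [] → l.IsChain (· ≠ ·) → l.length ≤ 2 * w.length →
      (l.map a).prod ≠ 1)
    (hw : w.IsChain fun l m => ∀ x y, κ l x ≠ κ m y) {ε : ℝ}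
    (hε : ∀ l ∈ w, density {z | κ l (π l z) = κ l z} ≤ ε) :
    density {p | (w.map fun l => skewPerm (fun z => Equiv.mulLeft (a (κ l z))) (π l)).prod p = p} ≤
      w.length * ε := by
  refine (density_mono ?_).trans
    ((density_preimage_fst_le _).trans (density_wordPath_le π κ w hε))
  rintro ⟨z, k⟩ hp hz
  rw [Set.mem_ofPred_eq, prod_map_skewPerm_apply π κ ha] at hp
  have h2 := congrArg Prod.snd hp
  simp only [mul_eq_right] at h2
  refine haw _ ?_ (wordPath_isChain π κ w z hw hz) (wordPath_length π κ w z).le h2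
  intro h
  have := wordPath_length π κ w z
  rw [h] at this
  simp only [List.length_nil] at this
  exact hw0 (List.length_eq_zero_iff.1 (by omega))

end Words

/-! ### Combining the two models -/

/-- Consecutive letters of the word come from different factors. -/
def IsAlternating {G H : Type*} (w : List (G ⊕ H)) : Prop :=
  w.IsChain fun l m => l.isLeft ≠ m.isLeft

/-- Compatible approximations of the two factors of an amalgamated product such that reduced words
act almost freely. -/
theorem exists_amalgam_permApprox {G H Λ : Type*} [Group G] [Group H] [Group Λ]
    (hG : HasPermApprox G) (hH : HasPermApprox H) (hΛ : IsAmenable Λ)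
    (ι : Λ →* G) (hι : Function.Injective ι) (κ : Λ →* H) (hκ : Function.Injective κ)
    (E₁ : Finset G) (E₂ : Finset H) (B : Finset Λ) (N : ℕ) {ε : ℝ} (hε : 0 < ε) :
    ∃ (Z : Type) (_ : Finite Z) (_ : Nonempty Z) (σ : G → Equiv.Perm Z) (τ : H → Equiv.Perm Z),
      density {z | ¬ IsGoodAt σ E₁ z} ≤ ε ∧ density {z | ¬ IsGoodAt τ E₂ z} ≤ ε ∧
      (∀ b ∈ B, density {z | σ (ι b) z ≠ τ (κ b) z} ≤ ε) ∧
      ∀ w : List (G ⊕ H), w ≠ [] → w.length ≤ N → IsAlternating w →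
        (∀ l ∈ w, Sum.elim (fun g => g ∈ E₁ ∧ g ∉ Set.range ι)
          (fun h => h ∈ E₂ ∧ h ∉ Set.range κ) l) →
        density {z | (w.map (Sum.elim σ τ)).prod z = z} ≤ ε := by
  classical
  -- Agreement on the amalgamated subgroup costs `14 * η` in all, and a word of length at most `N`
  -- costs `N * η`.
  set η : ℝ := ε / (20 * (N + 1)) with hη
  have hη0 : 0 < η := by positivity
  have hη20 : 20 * η ≤ ε := by
    have h1 : η * (20 * (N + 1)) = ε := by rw [hη]; field_simp
    have h2 : 0 ≤ η * N := by positivity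
    linarith
  have hηN : (N : ℝ) * η ≤ ε := by
    have h1 : η * (20 * (N + 1)) = ε := by rw [hη]; field_simp
    have h2 : 0 ≤ η * N := by positivity
    linarith
  obtain ⟨F, hF, hFδ⟩ := hΛ.exists_folner B hη0
  obtain ⟨X, hX, hX', σ, t, c, htF, hσ, ht, hc⟩ := exists_equivariant_position hG ι hι F B hF hFδ
    (E₁ ∪ (F ∪ B).image ι) hη0
  obtain ⟨Y, hY, hY', τ, t', c', htF', hτ, ht', hc'⟩ := exists_equivariant_position hH κ hκ F B hF
    hFδ (E₂ ∪ (F ∪ B).image κ) hη0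
  -- Length `2 * N`, since every letter of a word contributes two involutions.
  obtain ⟨K, _, hK, a, ha, haw⟩ := exists_finite_group_of_involutions (X ⊕ Y) (2 * N)
  have hι' : ∀ b ∈ F ∪ B, ι b ∈ E₁ ∪ (F ∪ B).image ι := fun b hb =>
    Finset.mem_union_right _ (Finset.mem_image_of_mem _ hb)
  have hκ' : ∀ b ∈ F ∪ B, κ b ∈ E₂ ∪ (F ∪ B).image κ := fun b hb =>
    Finset.mem_union_right _ (Finset.mem_image_of_mem _ hb)
  let s : G → Equiv.Perm (X × Y) := fun g => skewPerm (fun x => τ (κ (t x))) (σ g)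
  let s' : H → Equiv.Perm (X × Y) := fun h =>
    (Equiv.prodComm Y X).permCongr (skewPerm (fun y => σ (ι (t' y))) (τ h))
  let q : G ⊕ H → X × Y → X ⊕ Y :=
    Sum.elim (fun _ z => Sum.inl (c z.1)) (fun _ z => Sum.inr (c' z.2))
  let S : G → Equiv.Perm ((X × Y) × K) := fun g =>
    skewPerm (fun z => Equiv.mulLeft (a (q (Sum.inl g) z))) (s g)
  let S' : H → Equiv.Perm ((X × Y) × K) := fun h =>
    skewPerm (fun z => Equiv.mulLeft (a (q (Sum.inr h) z))) (s' h)
  have hs'good : ∀ z, IsGoodAt τ E₂ z.2 → IsGoodAt s' E₂ z := by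
    intro z hz a ha b hb
    obtain ⟨h1, h2⟩ := hz.skewPerm (p := (z.2, z.1)) (fun y => σ (ι (t' y))) a ha b hb
    exact ⟨congrArg Prod.swap h1, fun h => h2 (Prod.swap_injective h)⟩
  refine ⟨(X × Y) × K, inferInstance, inferInstance, S, S', ?_, ?_, ?_, ?_⟩
  · refine (density_mono ?_).trans ((density_preimage_fst_le
      (Prod.fst ⁻¹' {x | ¬ IsGoodAt σ (E₁ ∪ (F ∪ B).image ι) x})).trans
      ((density_preimage_fst_le _).trans (hσ.trans (by linarith))))
    intro z hz hg
    exact hz (IsGoodAt.skewPerm (σ := s)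
      ((hg.mono Finset.subset_union_left).skewPerm (p := z.1) _)
      fun z => Equiv.mulLeft (a (Sum.inl (c z.1))))
  · refine (density_mono ?_).trans ((density_preimage_fst_le
      (Prod.snd ⁻¹' {y | ¬ IsGoodAt τ (E₂ ∪ (F ∪ B).image κ) y})).trans
      ((density_preimage_snd_le _).trans (hτ.trans (by linarith))))
    intro z hz hg
    exact hz (IsGoodAt.skewPerm (σ := s') (hs'good _ (hg.mono Finset.subset_union_left))
      fun z => Equiv.mulLeft (a (Sum.inr (c' z.2))))
  · intro b hb
    -- Both actions of `b` are close to `σ (ι b) × τ (κ b)` on `X × Y`, and almost trivial on `K`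
    -- because `c` and `c'` are almost invariant.
    have d1 := density_skewPerm_ne_le κ τ (E₂ ∪ (F ∪ B).image κ) t
      (fun x => hκ' _ (Finset.mem_union_left _ (htF x))) (σ (ι b))
      (hκ' b (Finset.mem_union_right _ hb))
    have d2 := density_skewPerm_ne_le ι σ (E₁ ∪ (F ∪ B).image ι) t'
      (fun x => hι' _ (Finset.mem_union_left _ (htF' x))) (τ (κ b))
      (hι' b (Finset.mem_union_right _ hb))
    rw [← density_preimage (Equiv.prodComm X Y)] at d2
    have d3 := density_mono fun x (hx : t (σ (ι b) x) ≠ b * t x) =>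
      (fun h => hx h.1 : ¬ (t (σ (ι b) x) = b * t x ∧ c (σ (ι b) x) = c x))
    have d4 := density_mono fun x (hx : t' (τ (κ b) x) ≠ b * t' x) =>
      (fun h => hx h.1 : ¬ (t' (τ (κ b) x) = b * t' x ∧ c' (τ (κ b) x) = c' x))
    have d5 := (density_preimage_fst_le (V' := Y)
      {x | ¬ (t (σ (ι b) x) = b * t x ∧ c (σ (ι b) x) = c x)}).trans (ht b hb)
    have d6 := (density_preimage_snd_le (V := X)
      {x | ¬ (t' (τ (κ b) x) = b * t' x ∧ c' (τ (κ b) x) = c' x)}).trans (ht' b hb)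
    replace d1 := d1.trans (add_le_add (d3.trans (ht b hb)) hτ)
    replace d2 := d2.trans (add_le_add (d4.trans (ht' b hb)) hσ)
    refine (density_mono ?_).trans ((density_preimage_fst_le _).trans
      ((density_union_le _ _).trans ((add_le_add ((density_union_le _ _).trans (add_le_add d1 d2))
      ((density_union_le _ _).trans (add_le_add d5 d6))).trans (by linarith))))
    rintro ⟨z, k⟩ hz
    by_contra hcon
    simp only [Set.mem_union, Set.mem_preimage, Set.mem_ofPred_eq, not_or, not_not] at hcon
    obtain ⟨⟨h1, h2⟩, h3, h4⟩ := hcon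
    have h1' : s (ι b) z = (σ (ι b) z.1, τ (κ b) z.2) := h1
    have h2' : s' (κ b) z = (σ (ι b) z.1, τ (κ b) z.2) := congrArg Prod.swap h2
    apply hz
    simp only [S, S', skewPerm_apply, h1', h2', q, Sum.elim_inl, Sum.elim_inr, h3.2, h4.2]
    simp
  · intro w hw0 hwN hw hwE
    have hmap : w.map (Sum.elim S S') = w.map fun l =>
        skewPerm (fun z => Equiv.mulLeft (a (q l z))) (Sum.elim s s' l) := by
      apply List.map_congr_left
      rintro (g | h) - <;> rfl
    rw [hmap]
    refine (density_fixed_word_le (Sum.elim s s') q ha hw0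
      (fun l h1 h2 h3 => haw l h1 h2 (h3.trans (by omega))) ?_ (ε := η) ?_).trans (le_trans ?_ hηN)
    · refine hw.imp ?_
      rintro (g | h) (g' | h') hne x y
      · simp at hne
      · simp [q]
      · simp [q]
      · simp at hne
    · rintro (g | h) hl
      · obtain ⟨h1, h2⟩ := hwE _ hl
        refine (density_mono ?_).trans ((density_preimage_fst_le _).trans
          (hc g (Finset.mem_union_left _ h1) h2))
        intro z hz
        exact Sum.inl_injective hz
      · obtain ⟨h1, h2⟩ := hwE _ hl
        refine (density_mono ?_).trans ((density_preimage_snd_le _).trans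
          (hc' h (Finset.mem_union_left _ h1) h2))
        intro z hz
        exact Sum.inr_injective hz
    · gcongr

/-! ### Reduced words in amalgamated products -/

section ReducedWords
variable {G H Λ P : Type*} [Group G] [Group H] [Group Λ] [Group P]

/-- `p` is the image of an element of the amalgamated subgroup, or the product of an alternating
word whose letters lie outside of the amalgamated subgroup. -/
def HasReducedWord (ι : Λ →* G) (κ : Λ →* H) (i : G →* P) (j : H →* P) (p : P) : Prop :=
  (∃ c, p = i (ι c)) ∨ ∃ w : List (G ⊕ H), w ≠ [] ∧ IsAlternating w ∧
    (∀ l ∈ w, Sum.elim (fun g => g ∉ Set.range ι) (fun h => h ∉ Set.range κ) l) ∧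
    p = (w.map (Sum.elim i j)).prod

variable {ι : Λ →* G} {κ : Λ →* H} {i : G →* P} {j : H →* P}

theorem HasReducedWord.swap (hij : ∀ c, i (ι c) = j (κ c)) {p : P}
    (hp : HasReducedWord ι κ i j p) : HasReducedWord κ ι j i p := by
  rcases hp with ⟨c, rfl⟩ | ⟨w, h0, h1, h2, rfl⟩
  · exact Or.inl ⟨c, hij c⟩
  · refine Or.inr ⟨w.map Sum.swap, by simpa using h0, ?_, ?_, ?_⟩
    · unfold IsAlternating at h1 ⊢
      rw [List.isChain_map]
      refine h1.imp ?_
      rintro (g | h) (g' | h') hne <;> simp at hne ⊢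
    · intro l hl
      obtain ⟨m, hm, rfl⟩ := List.mem_map.1 hl
      have := h2 m hm
      cases m <;> simpa using this
    · rw [List.map_map]
      congr 2
      funext l
      cases l <;> rfl

theorem mul_notMem_range {A B : Type*} [Group A] [Group B] (f : A →* B) (c : A) {x : B}
    (hx : x ∉ Set.range f) : f c * x ∉ Set.range f := by
  rintro ⟨d, hd⟩
  exact hx ⟨c⁻¹ * d, by rw [map_mul, hd, map_inv, inv_mul_cancel_left]⟩

theorem HasReducedWord.inl_mul (hij : ∀ c, i (ι c) = j (κ c)) {p : P}
    (hp : HasReducedWord ι κ i j p) (g : G) : HasReducedWord ι κ i j (i g * p) := by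
  have single : ∀ g, HasReducedWord ι κ i j (i g) := by
    intro g
    by_cases hg : g ∈ Set.range ι
    · obtain ⟨c, rfl⟩ := hg
      exact Or.inl ⟨c, rfl⟩
    · exact Or.inr ⟨[Sum.inl g], by simp, List.isChain_singleton _, by simpa using hg, by simp⟩
  -- A factor from the amalgamated subgroup is absorbed by the following letter from `H`, which
  -- stays outside the subgroup.
  have absorb : ∀ c h (w : List (G ⊕ H)), IsAlternating (Sum.inr h :: w) →
      (∀ l ∈ Sum.inr h :: w,
        Sum.elim (fun g => g ∉ Set.range ι) (fun h => h ∉ Set.range κ) l) →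
      HasReducedWord ι κ i j (i (ι c) * ((Sum.inr h :: w).map (Sum.elim i j)).prod) := by
    intro c h w h1 h2
    refine Or.inr ⟨Sum.inr (κ c * h) :: w, by simp, ?_, ?_, ?_⟩
    · unfold IsAlternating at h1 ⊢
      rw [List.isChain_cons] at h1 ⊢
      exact h1
    · rw [List.forall_mem_cons] at h2 ⊢
      exact ⟨mul_notMem_range κ c h2.1, h2.2⟩
    · simp [hij, mul_assoc]
  rcases hp with ⟨c, rfl⟩ | ⟨w, h0, h1, h2, rfl⟩
  · rw [← map_mul]
    exact single _
  · match w, h0, h1, h2 with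
    | Sum.inl g' :: w, _, h1, h2 =>
      have hprod : i g * ((Sum.inl g' :: w).map (Sum.elim i j)).prod =
          i (g * g') * (w.map (Sum.elim i j)).prod := by simp [mul_assoc]
      rw [hprod]
      by_cases hg : g * g' ∈ Set.range ι
      · obtain ⟨c, hc⟩ := hg
        rw [← hc]
        match w, h1, h2 with
        | [], _, _ => exact Or.inl ⟨c, by simp⟩
        | Sum.inl g'' :: w, h1, _ => exact absurd rfl (List.isChain_cons_cons.1 h1).1
        | Sum.inr h :: w, h1, h2 =>
          exact absorb c h w h1.tail fun l hl => h2 l (List.mem_cons_of_mem _ hl)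
      · refine Or.inr ⟨Sum.inl (g * g') :: w, by simp, ?_, ?_, by simp⟩
        · unfold IsAlternating at h1 ⊢
          rw [List.isChain_cons] at h1 ⊢
          exact h1
        · rw [List.forall_mem_cons] at h2 ⊢
          exact ⟨hg, h2.2⟩
    | Sum.inr h :: w, _, h1, h2 =>
      by_cases hg : g ∈ Set.range ι
      · obtain ⟨c, rfl⟩ := hg
        exact absorb c h w h1 h2
      · refine Or.inr ⟨Sum.inl g :: Sum.inr h :: w, by simp, ?_, ?_, by simp⟩
        · exact List.isChain_cons_cons.2 ⟨by simp, h1⟩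
        · rw [List.forall_mem_cons]
          exact ⟨hg, h2⟩

theorem HasReducedWord.inr_mul (hij : ∀ c, i (ι c) = j (κ c)) {p : P}
    (hp : HasReducedWord ι κ i j p) (h : H) : HasReducedWord ι κ i j (j h * p) :=
  ((hp.swap hij).inl_mul (fun c => (hij c).symm) h).swap fun c => (hij c).symm

end ReducedWords

namespace AmalgamatedProduct
variable {G H : Type*} [Group G] [Group H] (Γ : Subgroup G) (φ : Γ →* H)

/-- The canonical map from the first factor. -/
def inl : G →* AmalgamatedProduct Γ φ := (QuotientGroup.mk' _).comp Monoid.Coprod.inl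

/-- The canonical map from the second factor. -/
def inr : H →* AmalgamatedProduct Γ φ := (QuotientGroup.mk' _).comp Monoid.Coprod.inr

theorem inl_eq_inr (c : Γ) : inl Γ φ (Γ.subtype c) = inr Γ φ (φ c) := by
  have : (Monoid.Coprod.inl (c : G) : Monoid.Coprod G H) * (Monoid.Coprod.inr (φ c))⁻¹ ∈
      Subgroup.normalClosure (Set.range fun γ : Γ =>
        (Monoid.Coprod.inl (γ : G) : Monoid.Coprod G H) * (Monoid.Coprod.inr (φ γ))⁻¹) :=
    Subgroup.subset_normalClosure ⟨c, rfl⟩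
  rw [← QuotientGroup.eq_one_iff] at this
  exact eq_of_mul_inv_eq_one this

/-- The elements with a reduced word contain `1` and are stable under left multiplication by both
factors, which generate. -/
theorem hasReducedWord (p : AmalgamatedProduct Γ φ) :
    HasReducedWord Γ.subtype φ (inl Γ φ) (inr Γ φ) p := by
  obtain ⟨x, rfl⟩ := QuotientGroup.mk_surjective p
  suffices ∀ p, HasReducedWord Γ.subtype φ (inl Γ φ) (inr Γ φ) p →
      HasReducedWord Γ.subtype φ (inl Γ φ) (inr Γ φ) ((x : AmalgamatedProduct Γ φ) * p) by
    have := this 1 (Or.inl ⟨1, by simp⟩)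
    rwa [mul_one] at this
  induction x using Monoid.Coprod.induction_on with
  | inl g => exact fun p hp => hp.inl_mul (inl_eq_inr Γ φ) g
  | inr h => exact fun p hp => hp.inr_mul (inl_eq_inr Γ φ) h
  | mul x y hx hy =>
    intro p hp
    rw [QuotientGroup.mk_mul, mul_assoc]
    exact hx _ (hy _ hp)

variable {Γ φ}

/-- The universal property. -/
def lift {Q : Type*} [Group Q] (f : G →* Q) (g : H →* Q) (hfg : ∀ c : Γ, f c = g (φ c)) :
    AmalgamatedProduct Γ φ →* Q :=
  QuotientGroup.lift _ (Monoid.Coprod.lift f g) <| by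
    have : Subgroup.normalClosure (Set.range fun γ : Γ =>
        (Monoid.Coprod.inl (γ : G) : Monoid.Coprod G H) * (Monoid.Coprod.inr (φ γ))⁻¹) ≤
        (Monoid.Coprod.lift f g).ker := by
      apply Subgroup.normalClosure_le_normal
      rintro _ ⟨c, rfl⟩
      simp [MonoidHom.mem_ker, hfg]
    exact fun x hx => this hx

theorem lift_inl {Q : Type*} [Group Q] (f : G →* Q) (g : H →* Q)
    (hfg : ∀ c : Γ, f c = g (φ c)) (x : G) : lift f g hfg (inl Γ φ x) = f x :=
  Monoid.Coprod.lift_apply_inl f g x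

theorem lift_inr {Q : Type*} [Group Q] (f : G →* Q) (g : H →* Q)
    (hfg : ∀ c : Γ, f c = g (φ c)) (x : H) : lift f g hfg (inr Γ φ x) = g x :=
  Monoid.Coprod.lift_apply_inr f g x

end AmalgamatedProduct

/-! ### The limit of a family of finite symmetric groups -/

section Limit
variable {I : Type*} {Z : I → Type} {l : Filter I}

/-- The density of the sets `s i` tends to zero. -/
def IsNullFamily (l : Filter I) (s : ∀ i, Set (Z i)) : Prop :=
  ∀ ε > (0 : ℝ), ∀ᶠ i in l, density (s i) ≤ ε

theorem IsNullFamily.union {s t : ∀ i, Set (Z i)} (hs : IsNullFamily l s)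
    (ht : IsNullFamily l t) : IsNullFamily l fun i => s i ∪ t i := fun ε hε => by
  filter_upwards [hs (ε / 2) (by positivity), ht (ε / 2) (by positivity)] with i h1 h2
  exact (density_union_le _ _).trans (by linarith)

theorem IsNullFamily.biUnion {J : Type*} (E : Finset J) {s : J → ∀ i, Set (Z i)}
    (hs : ∀ j ∈ E, IsNullFamily l (s j)) : IsNullFamily l fun i => ⋃ j ∈ E, s j i := by
  classical
  induction E using Finset.induction_on with
  | empty => intro ε hε; simp [density_empty, hε.le]
  | insert a E ha ih =>
    simp only [Finset.set_biUnion_insert]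
    exact (hs a (by simp)).union (ih fun j hj => hs j (by simp [hj]))

variable [∀ i, Finite (Z i)]

theorem IsNullFamily.mono {s t : ∀ i, Set (Z i)} (ht : IsNullFamily l t) (h : ∀ i, s i ⊆ t i) :
    IsNullFamily l s := fun ε hε => (ht ε hε).mono fun i hi => (density_mono (h i)).trans hi

/-- The families of permutations that move few points. -/
def nullPerms (l : Filter I) (Z : I → Type) [∀ i, Finite (Z i)] :
    Subgroup (∀ i, Equiv.Perm (Z i)) where
  carrier := {x | IsNullFamily l fun i => {z | x i z ≠ z}}
  one_mem' := fun ε hε => by simp [density_empty, hε.le]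
  mul_mem' {x y} hx hy := (hx.union hy).mono fun i z hz => by
    by_contra hcon
    simp only [Set.mem_union, Set.mem_ofPred_eq, not_or, not_not] at hcon
    apply hz
    rw [Pi.mul_apply, Equiv.Perm.mul_apply, hcon.2, hcon.1]
  inv_mem' {x} hx := hx.mono fun i z hz h => hz <| by
    rw [Pi.inv_apply, Equiv.Perm.inv_eq_iff_eq, h]

instance : (nullPerms l Z).Normal where
  conj_mem x hx g := fun ε hε => (hx ε hε).mono fun i hi => by
    rw [← density_preimage (g i)⁻¹] at hi
    refine (density_mono ?_).trans hi
    intro z hz h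
    apply hz
    simp only [Pi.mul_apply, Pi.inv_apply, Equiv.Perm.mul_apply]
    rw [h]
    simp

/-- Asymptotically good maps to finite symmetric groups define a homomorphism to the quotient by the
families of permutations that move few points. -/
def limitHom {G : Type*} [Group G] (σ : ∀ i, G → Equiv.Perm (Z i))
    (hσ : ∀ E, IsNullFamily l fun i => {z | ¬ IsGoodAt (σ i) E z}) :
    G →* (∀ i, Equiv.Perm (Z i)) ⧸ nullPerms l Z :=
  MonoidHom.mk' (fun g => ((fun i => σ i g : ∀ i, Equiv.Perm (Z i)) :
      (∀ i, Equiv.Perm (Z i)) ⧸ nullPerms l Z)) <| fun a b => by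
    classical
    rw [← QuotientGroup.mk_mul, QuotientGroup.eq]
    refine (hσ {a, b}).mono fun i z hz hg => hz ?_
    simp only [Pi.mul_apply, Pi.inv_apply, Equiv.Perm.mul_apply]
    rw [← (hg a (by simp) b (by simp)).1]
    simp

/-- Having few fixed points depends only on the class modulo `nullPerms`, so it can be checked on
any representative. -/
theorem isNullFamily_fixed_of_mk_eq {x y : ∀ i, Equiv.Perm (Z i)}
    (hxy : (x : (∀ i, Equiv.Perm (Z i)) ⧸ nullPerms l Z) = y)
    (hx : IsNullFamily l fun i => {z | x i z = z}) :
    IsNullFamily l fun i => {z | y i z = z} := by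
  rw [QuotientGroup.eq] at hxy
  refine (hx.union hxy).mono fun i z hz => ?_
  by_contra hcon
  simp only [Set.mem_union, Set.mem_ofPred_eq, not_or, not_not] at hcon
  obtain ⟨h1, h2⟩ := hcon
  simp only [Pi.mul_apply, Pi.inv_apply, Equiv.Perm.mul_apply] at h2
  rw [show y i z = z from hz, Equiv.Perm.inv_eq_iff_eq] at h2
  exact h1 h2.symm

/-- A homomorphism to the limit that separates points almost everywhere gives finite
approximations. -/
theorem hasPermApprox_of_limitHom [l.NeBot] [∀ i, Nonempty (Z i)] {P : Type*} [Group P]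
    (Ψ : P →* (∀ i, Equiv.Perm (Z i)) ⧸ nullPerms l Z)
    (hΨ : ∀ p ≠ 1, ∃ x : ∀ i, Equiv.Perm (Z i),
      (x : (∀ i, Equiv.Perm (Z i)) ⧸ nullPerms l Z) = Ψ p ∧
      IsNullFamily l fun i => {z | x i z = z}) : HasPermApprox P := by
  classical
  have hs : ∀ p, ∃ x : ∀ i, Equiv.Perm (Z i),
      (x : (∀ i, Equiv.Perm (Z i)) ⧸ nullPerms l Z) = Ψ p :=
    fun p => QuotientGroup.mk_surjective (Ψ p)
  choose s hs using hs
  intro E ε hε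
  have h1 : ∀ a b, IsNullFamily l fun i => {z | s (a * b) i z ≠ s a i (s b i z)} := by
    intro a b
    have : (s (a * b) : (∀ i, Equiv.Perm (Z i)) ⧸ nullPerms l Z) =
        ((s a * s b : ∀ i, Equiv.Perm (Z i)) : (∀ i, Equiv.Perm (Z i)) ⧸ nullPerms l Z) := by
      rw [QuotientGroup.mk_mul, hs, hs, hs, map_mul]
    rw [QuotientGroup.eq] at this
    refine IsNullFamily.mono this fun i z hz h => hz ?_
    simp only [Pi.mul_apply, Pi.inv_apply, Equiv.Perm.mul_apply] at h
    rw [Equiv.Perm.inv_eq_iff_eq] at h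
    exact h.symm
  have h2 : ∀ a b, IsNullFamily l fun i => {z | a ≠ b ∧ s a i z = s b i z} := by
    intro a b
    by_cases hab : a = b
    · intro ε hε
      simp [hab, density_empty, hε.le]
    -- A point where `s a` and `s b` agree is fixed by `(s b)⁻¹ * s a`, which represents the image
    -- of `b⁻¹ * a ≠ 1`.
    · obtain ⟨x, hx, hx'⟩ := hΨ (b⁻¹ * a) (by rwa [ne_eq, inv_mul_eq_one, eq_comm])
      have hy : (x : (∀ i, Equiv.Perm (Z i)) ⧸ nullPerms l Z) =
          (((s b)⁻¹ * s a : ∀ i, Equiv.Perm (Z i)) : (∀ i, Equiv.Perm (Z i)) ⧸ nullPerms l Z) := by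
        rw [hx, QuotientGroup.mk_mul, QuotientGroup.mk_inv, hs, hs, map_mul, map_inv]
      refine (isNullFamily_fixed_of_mk_eq hy hx').mono fun i z hz => ?_
      simp only [Set.mem_ofPred_eq, Pi.mul_apply, Pi.inv_apply, Equiv.Perm.mul_apply]
      rw [hz.2]
      simp
  have h3 := IsNullFamily.biUnion (E ×ˢ E) fun j _ => (h1 j.1 j.2).union (h2 j.1 j.2)
  obtain ⟨i, hi⟩ := (h3 ε hε).exists
  refine ⟨Z i, inferInstance, inferInstance, fun p => s p i, (density_mono ?_).trans hi⟩
  intro z hz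
  by_contra hcon
  simp only [Set.mem_iUnion, not_exists] at hcon
  refine hz fun a ha b hb => ?_
  have := hcon (a, b) (Finset.mk_mem_product ha hb)
  simp only [Set.mem_union, Set.mem_ofPred_eq, not_or, not_not, not_and] at this
  exact ⟨this.1, fun h => by_contra fun hne => this.2 hne h⟩

end Limit

theorem mk_prod_map_sum_elim {I L P : Type*} {Z : I → Type} [∀ i, Finite (Z i)] {l : Filter I}
    [Group P] (π : ∀ i, L → Equiv.Perm (Z i)) (f : L → P)
    (Ψ : P →* (∀ i, Equiv.Perm (Z i)) ⧸ nullPerms l Z)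
    (h : ∀ a, ((fun i => π i a : ∀ i, Equiv.Perm (Z i)) :
      (∀ i, Equiv.Perm (Z i)) ⧸ nullPerms l Z) = Ψ (f a)) (w : List L) :
    ((fun i => (w.map (π i)).prod : ∀ i, Equiv.Perm (Z i)) :
      (∀ i, Equiv.Perm (Z i)) ⧸ nullPerms l Z) = Ψ (w.map f).prod := by
  induction w with
  | nil => simp only [List.map_nil, List.prod_nil, map_one]; rfl
  | cons a w ih =>
    simp only [List.map_cons, List.prod_cons, map_mul]
    rw [← ih, ← h]
    rfl

/-! ### Conclusion for amalgamated products -/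

theorem AmalgamatedProduct.hasPermApprox_of_isNullFamily {G H I : Type*} [Group G] [Group H]
    {Z : I → Type} [∀ i, Finite (Z i)] [∀ i, Nonempty (Z i)] {l : Filter I} [l.NeBot]
    (Γ : Subgroup G) (φ : Γ →* H) (σ : ∀ i, G → Equiv.Perm (Z i)) (τ : ∀ i, H → Equiv.Perm (Z i))
    (hσ : ∀ E, IsNullFamily l fun i => {z | ¬ IsGoodAt (σ i) E z})
    (hτ : ∀ E, IsNullFamily l fun i => {z | ¬ IsGoodAt (τ i) E z})
    (hΓ : ∀ c : Γ, IsNullFamily l fun i => {z | σ i c z ≠ τ i (φ c) z})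
    (hw : ∀ w : List (G ⊕ H), w ≠ [] → IsAlternating w →
      (∀ l ∈ w, Sum.elim (fun g => g ∉ Set.range Γ.subtype) (fun h => h ∉ Set.range φ) l) →
      IsNullFamily l fun i => {z | (w.map (Sum.elim (σ i) (τ i))).prod z = z}) :
    HasPermApprox (AmalgamatedProduct Γ φ) := by
  classical
  have hfg : ∀ c : Γ, limitHom σ hσ c = limitHom τ hτ (φ c) := by
    intro c
    refine (QuotientGroup.eq).2 ((hΓ c).mono fun i z hz h => hz ?_)
    simp only [Pi.mul_apply, Pi.inv_apply, Equiv.Perm.mul_apply]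
    rw [← h]
    exact Equiv.symm_apply_apply _ _
  refine hasPermApprox_of_limitHom (AmalgamatedProduct.lift _ _ hfg) fun p hp => ?_
  rcases AmalgamatedProduct.hasReducedWord Γ φ p with ⟨c, rfl⟩ | ⟨w, hw0, hw1, hw2, rfl⟩
  · refine ⟨fun i => σ i c, (AmalgamatedProduct.lift_inl _ _ hfg _).symm, ?_⟩
    -- At a good point `σ 1` is the identity, so a fixed point of `σ c` would force `c = 1`.
    refine (hσ {1, (c : G)}).mono fun i z hz hg => hp ?_
    have h5 := hg.one_apply (by simp)
    have h6 := (hg c (by simp) 1 (by simp)).2 (by rw [h5]; exact hz)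
    rw [Subgroup.coe_subtype, h6, map_one]
  · refine ⟨fun i => (w.map (Sum.elim (σ i) (τ i))).prod, ?_, hw w hw0 hw1 hw2⟩
    refine mk_prod_map_sum_elim (fun i => Sum.elim (σ i) (τ i)) _ _ ?_ w
    rintro (g | h)
    · exact (AmalgamatedProduct.lift_inl _ _ hfg g).symm
    · exact (AmalgamatedProduct.lift_inr _ _ hfg h).symm

theorem isNullFamily_atTop {G H Λ : Type*} {Z : Finset G × Finset H × Finset Λ × ℕ → Type}
    {s : ∀ i, Set (Z i)} (E₁ : Finset G) (E₂ : Finset H) (B : Finset Λ) (N : ℕ)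
    (hs : ∀ i, E₁ ⊆ i.1 → E₂ ⊆ i.2.1 → B ⊆ i.2.2.1 → N ≤ i.2.2.2 →
      density (s i) ≤ 1 / ((i.2.2.2 : ℝ) + 1)) : IsNullFamily Filter.atTop s := by
  intro ε hε
  obtain ⟨n, hn⟩ := exists_nat_one_div_lt hε
  filter_upwards [Filter.eventually_ge_atTop (E₁, E₂, B, N),
    Filter.eventually_ge_atTop (E₁, E₂, B, n)] with i hi hi'
  refine (hs i hi.1 hi.2.1 hi.2.2.1 hi.2.2.2).trans (le_trans ?_ hn.le)
  have : n ≤ i.2.2.2 := hi'.2.2.2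
  gcongr

/-- The models are indexed by the directed set of tuples (finite sets, word length `N`), with error
`1 / (N + 1)`, so every single requirement holds eventually and with error tending to zero. -/
theorem AmalgamatedProduct.hasPermApprox {G H : Type*} [Group G] [Group H] (hG : HasPermApprox G)
    (hH : HasPermApprox H) (Γ : Subgroup G) (hΓ : IsAmenable Γ) (φ : Γ →* H)
    (hφ : Function.Injective φ) : HasPermApprox (AmalgamatedProduct Γ φ) := by
  classical
  have hex := fun i : Finset G × Finset H × Finset Γ × ℕ =>
    exists_amalgam_permApprox hG hH hΓ Γ.subtype Γ.subtype_injective φ hφ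
    i.1 i.2.1 i.2.2.1 i.2.2.2 (ε := 1 / ((i.2.2.2 : ℝ) + 1)) (by positivity)
  choose Z hZ hZ' σ τ h1 h2 h3 h4 using hex
  refine AmalgamatedProduct.hasPermApprox_of_isNullFamily (l := Filter.atTop) Γ φ σ τ
    (fun E => ?_) (fun E => ?_) (fun c => ?_) fun w hw0 hw1 hw2 => ?_
  · refine isNullFamily_atTop E ∅ ∅ 0 fun i hi _ _ _ => le_trans (density_mono ?_) (h1 i)
    exact fun z hz hg => hz (hg.mono hi)
  · refine isNullFamily_atTop ∅ E ∅ 0 fun i _ hi _ _ => le_trans (density_mono ?_) (h2 i)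
    exact fun z hz hg => hz (hg.mono hi)
  · exact isNullFamily_atTop ∅ ∅ {c} 0 fun i _ _ hi _ => h3 i c (hi (Finset.mem_singleton_self c))
  · refine isNullFamily_atTop (w.filterMap Sum.getLeft?).toFinset
      (w.filterMap Sum.getRight?).toFinset ∅ w.length
      fun i hi1 hi2 _ hi3 => h4 i w hw0 hi3 hw1 ?_
    rintro (g | h) hl
    · exact ⟨hi1 (by simp [hl]), hw2 _ hl⟩
    · exact ⟨hi2 (by simp [hl]), hw2 _ hl⟩

theorem theorem1 {G H : Type*} [Group G] [Group H] (hG : IsSofic G) (hH : IsSofic H)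
    (Γ : Subgroup G) (hΓ : IsAmenable Γ) (φ : Γ →* H) (hφ : Function.Injective φ) :
    IsSofic (AmalgamatedProduct Γ φ) :=
  (AmalgamatedProduct.hasPermApprox hG.hasPermApprox hH.hasPermApprox Γ hΓ φ hφ).isSofic
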